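/- Let $\{\xi_{n,j},\varepsilon_n\}_{n,j\in\{1,2,\dots\}}$ be independent random variables with values in $\{0,1,2,\dots\}$ such that for each $n$ the variables $\xi_{n,1},\xi_{n,2},\dots$ have the same distribution as a variable $\xi_n$. Let $Y_0=0$ and $Y_n=\sum_{j=1}^{Y_{n-1}}\xi_{n,j}+\varepsilon_n$ for $n\ge 1$. Put $f_n(s)=\mathbf E s^{\xi_n}$, $\overline f_n=f_n'(1)=\mathbf E\xi_n$, $f_n''(1)=\mathbf E[\xi_n(\xi_n-1)]$, $f_n'''(1)=\mathbf E[\xi_n(\xi_n-1)(\xi_n-2)]$ and $m_{n,k}=\mathbf E[\varepsilon_n(\varepsilon_n-1)\cdots(\varepsilon_n-k+1)]$, all with values in $[0,\infty]$. Assume that: (C1) $\overline f_n<1$ for all $n$, $\lim_{n\to\infty}\overline f_n=1$, and $\sum_{n=1}^\infty(1-\overline f_n)=\infty$; (C2) $\lim_{n\to\infty}\frac{f_n''(1)}{1-\overline f_n}=\nu\in[0,\infty)$; (C3) if $\nu>0$, then $\lim_{n\to\infty}\frac{f_n'''(1)}{1-\overline f_n}=0$; (C4) for some integer $K\ge 1$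 and some $\lambda_1,\dots,\lambda_K\in[0,\infty)$ with $\lambda_K=0$, $\lim_{n\to\infty}\frac{m_{n,k}}{k!(1-\overline f_n)}=\lambda_k$ for $k=1,\dots,K$. Then $Y_n$ converges in distribution, without normalization, as $n\to\infty$ to a random variable $Y$ with values in $\{0,1,2,\dots\}$ which has a compound-Poisson distribution, that is, the distribution of $\sum_{i=1}^N Z_i$, where $Z_1,Z_2,\dots$ are i.i.d. nonnegative integer-valued random variables and $N$ is an independent Poisson variable with parameter $\theta\in[0,\infty)$. If $\nu>0$, its generating function is, for $s\in[0,1]$, $$f_Y(s)=\exp\left\{-\sum_{k=1}^{K-1}\frac{2^k\lambda_k}{\nu^k}\left(\log\left(1+\frac{\nu}{2}(1-s)\right)+\sum_{i=1}^{k-1}(-1)^i\frac{\nu^i}{i2^i}(1-s)^i\right)\right\}.$$ If $\nu=0$, its generating function is the limit of this expression as $\nu\downarrow 0$, that is, $f_Y(s)=\exp\left\{\sum_{k=1}^{K-1}\frac{(-1)^k\lambda_k}{k}(1-s)^k\right\}$ for $s\in[0,1]$. -/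

import Mathlib

open MeasureTheory ProbabilityTheory Filter Topology
open scoped NNReal ENNReal

noncomputable section

namespace BranchingImmigration

variable {Ω : Type*} [MeasurableSpace Ω]

/-- Generations and individuals are numbered from `0` here: `ξ n j` is the number of offspring
`ξ_{n+1,j+1}` of the `(j+1)`-st individual of generation `n`, and `ε n` is the number
`ε_{n+1}` of immigrants joining generation `n + 1`.  All these variables are independent, and for
every `n` the variables `ξ n j`, `j = 0, 1, …`, have the same law. -/
structure IsBranchingInput (P : Measure Ω) (ξ : ℕ → ℕ → Ω → ℕ) (ε : ℕ → Ω → ℕ) : Prop where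
  measurable_offspring : ∀ n j, Measurable (ξ n j)
  measurable_immigration : ∀ n, Measurable (ε n)
  indep : iIndepFun (Sum.elim (fun p : ℕ × ℕ => ξ p.1 p.2) ε) P
  identDistrib : ∀ n j, IdentDistrib (ξ n j) (ξ n 0) P P

/-- The branching process with immigration: `Y_0 = 0` and
`Y_{n+1} = ∑_{j=1}^{Y_n} ξ_{n+1,j} + ε_{n+1}`. -/
def processWithImmigration (ξ : ℕ → ℕ → Ω → ℕ) (ε : ℕ → Ω → ℕ) : ℕ → Ω → ℕ
  | 0, _ => 0
  | n + 1, ω => (∑ j ∈ Finset.range (processWithImmigration ξ ε n ω), ξ n j ω) + ε n ω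

/-- The factorial moment `E[X (X - 1) ⋯ (X - k + 1)]`, with values in `[0, ∞]`.  It is also the
value at `1` of the `k`-th derivative of the generating function `s ↦ E[s ^ X]`. -/
def factorialMoment (P : Measure Ω) (X : Ω → ℕ) (k : ℕ) : ℝ≥0∞ :=
  ∫⁻ ω, ((X ω).descFactorial k : ℝ≥0∞) ∂P

/-- The mean number of offspring in a generation; this is `f_{n+1}'(1)`. -/
def offspringMean (P : Measure Ω) (ξ : ℕ → ℕ → Ω → ℕ) (n : ℕ) : ℝ≥0∞ :=
  ∫⁻ ω, (ξ n 0 ω : ℝ≥0∞) ∂P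

/-- The law of `∑_{i=1}^N Z_i`, where `N` has the Poisson law with parameter `θ`, the `Z_i` have
law `Q`, and all these variables are independent. -/
def compoundPoisson (θ : ℝ≥0) (Q : Measure ℕ) : Measure ℕ :=
  ((poissonMeasure θ).prod (Measure.infinitePi fun _ : ℕ => Q)).map
    fun p : ℕ × (ℕ → ℕ) => ∑ i ∈ Finset.range p.1, p.2 i

/-- Compound-Poisson laws on the nonnegative integers. -/
def IsCompoundPoisson (μ : Measure ℕ) : Prop :=
  ∃ (θ : ℝ≥0) (Q : Measure ℕ), IsProbabilityMeasure Q ∧ μ = compoundPoisson θ Q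

/-- The generating function of the limit law for `ν > 0`. -/
def limitGF (ν : ℝ) (lam : ℕ → ℝ) (K : ℕ) (s : ℝ) : ℝ :=
  Real.exp (-∑ k ∈ Finset.Icc 1 (K - 1), 2 ^ k * lam k / ν ^ k *
    (Real.log (1 + ν / 2 * (1 - s)) +
      ∑ i ∈ Finset.Icc 1 (k - 1), (-1) ^ i * (ν ^ i / (i * 2 ^ i)) * (1 - s) ^ i))

/-- The pointwise limit of `limitGF ν lam K s` as `ν` decreases to `0`, which is the generating
function of the limit law for `ν = 0`. -/
def limitGFZero (lam : ℕ → ℝ) (K : ℕ) (s : ℝ) : ℝ :=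
  Real.exp (∑ k ∈ Finset.Icc 1 (K - 1), (-1) ^ k * lam k * (1 - s) ^ k / k)

end BranchingImmigration

end

/-! Put `x = 1 - s`, `U_n(x) = 1 - E (1 - x)^{ξ_n}` and `V_n(x) = 1 - E (1 - x)^{ε_n}`. Conditioning
on successive generations gives `E (1 - x)^{Y_n} = ∏_{j < n} (1 - V_j(y_{j+1}))`, where `y_n = x`
and `y_j = U_j(y_{j+1})`.

Let `a_n` be the defect of the offspring mean, `r = ν / 2` and `p(x) = ∑_k λ_k (-x)^{k-1}`. The
Bonferroni inequalities turn the moment conditions into `x - U_n(x) = a_n (x + r x²) + o(a_n x)` and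
`V_n(x) = a_n x p(x) + o(a_n x)`, uniformly on `[0, 1]`. Hence `V_j(y_{j+1})` is nearly `p / (1 + r
·)` at `y_{j+1}` times the decrement `y_{j+1} - y_j`. Since the defects are not summable, `y_0`
tends to `0`, so `∑ V_j(y_{j+1})` behaves like a Riemann sum for `H(x) = ∫_0^x p(u) / (1 + r u) du`,
and the product tends to `exp (-H(x))`. The analytic core is `increment_estimate` and
`tendsto_sum_and_prod_chain`; the explicit formulas are primitives of `p / (1 + r ·)`.

For the compound-Poisson property, `V_j(y_{j+1})` is one minus the generating function of the
descendants of the immigrants of a single generation. So `H(1) - H(1 - s)` is a limit of power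
series with bounded nonnegative coefficients, hence itself such a series. Normalized, it is the
generating function of the summands `Z_i`, and the Poisson parameter is `H(1)`; if `H(1) = 0` the
limit is `0`. Both steps are in the two lemmas named `exists_compoundPoisson`. -/

namespace BranchingImmigration

/-! ### Backward chains of contractions, and Riemann sums along them. -/

/-- The composition `U j ∘ U (j + 1) ∘ ⋯ ∘ U (n - 1)`. -/
def chain (U : ℕ → ℝ → ℝ) (j : ℕ) : ℕ → ℝ → ℝ
  | 0, x => x
  | n + 1, x => if j ≤ n then chain U j n (U n x) else x

section Chain

variable {U : ℕ → ℝ → ℝ}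

theorem chain_of_le {j n : ℕ} (h : n ≤ j) (x : ℝ) : chain U j n x = x := by
  cases n with
  | zero => rfl
  | succ n => rw [chain, if_neg (by omega)]

theorem chain_succ {j n : ℕ} (h : j ≤ n) (x : ℝ) :
    chain U j (n + 1) x = chain U j n (U n x) := by
  rw [chain, if_pos h]

/-- The recursion for generating functions peels off the innermost map, as in the definition.
Peeling off the outermost one exhibits consecutive points of a chain, so that sums of decrements
telescope. -/
theorem chain_eq_apply {j n : ℕ} (h : j < n) (x : ℝ) :
    chain U j n x = U j (chain U (j + 1) n x) := by
  induction n generalizing x with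
  | zero => omega
  | succ n ih =>
    rcases Nat.lt_succ_iff_lt_or_eq.1 h with h | rfl
    · rw [chain_succ h.le, ih h, chain_succ h]
    · rw [chain_succ le_rfl, chain_of_le le_rfl, chain_of_le le_rfl]

theorem chain_mem (hU : ∀ n, ∀ x ∈ Set.Icc (0 : ℝ) 1, U n x ∈ Set.Icc (0 : ℝ) 1)
    (j n : ℕ) {x : ℝ} (hx : x ∈ Set.Icc (0 : ℝ) 1) : chain U j n x ∈ Set.Icc (0 : ℝ) 1 := by
  induction n generalizing x with
  | zero => exact hx
  | succ n ih =>
    rw [chain]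
    split_ifs
    · exact ih (hU n x hx)
    · exact hx

theorem contraction_mem {a : ℕ → ℝ} (ha0 : ∀ n, 0 ≤ a n)
    (hU0 : ∀ n, ∀ x ∈ Set.Icc (0 : ℝ) 1, 0 ≤ U n x)
    (hU1 : ∀ n, ∀ x ∈ Set.Icc (0 : ℝ) 1, U n x ≤ (1 - a n) * x) (n : ℕ) (x : ℝ)
    (hx : x ∈ Set.Icc (0 : ℝ) 1) : U n x ∈ Set.Icc (0 : ℝ) 1 :=
  ⟨hU0 n x hx, (hU1 n x hx).trans (by nlinarith [hx.1, hx.2, ha0 n])⟩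

/-- Each map contracts by `1 - a i ≤ exp (-a i)`; non-summability of `a` then drives the chains to
`0`. -/
theorem chain_le_exp {a : ℕ → ℝ} (ha0 : ∀ n, 0 ≤ a n)
    (hU0 : ∀ n, ∀ x ∈ Set.Icc (0 : ℝ) 1, 0 ≤ U n x)
    (hU1 : ∀ n, ∀ x ∈ Set.Icc (0 : ℝ) 1, U n x ≤ (1 - a n) * x) (j n : ℕ) {x : ℝ}
    (hx : x ∈ Set.Icc (0 : ℝ) 1) :
    chain U j n x ≤ Real.exp (-∑ i ∈ Finset.Ico j n, a i) * x := by
  induction n generalizing x with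
  | zero => simp [chain]
  | succ n ih =>
    rcases le_or_gt j n with h | h
    · rw [chain_succ h, Finset.sum_Ico_succ_top h, neg_add, Real.exp_add]
      refine (ih (contraction_mem ha0 hU0 hU1 n x hx)).trans ?_
      rw [mul_assoc]
      refine mul_le_mul_of_nonneg_left ((hU1 n x hx).trans ?_) (Real.exp_pos _).le
      exact mul_le_mul_of_nonneg_right (Real.one_sub_le_exp_neg _) hx.1
    · rw [chain_of_le (by omega), Finset.Ico_eq_empty (by omega)]
      simp

theorem chain_tendsto_zero {a : ℕ → ℝ} (ha0 : ∀ n, 0 ≤ a n) (hasum : ¬ Summable a)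
    (hU0 : ∀ n, ∀ x ∈ Set.Icc (0 : ℝ) 1, 0 ≤ U n x)
    (hU1 : ∀ n, ∀ x ∈ Set.Icc (0 : ℝ) 1, U n x ≤ (1 - a n) * x) (j : ℕ) {x : ℝ}
    (hx : x ∈ Set.Icc (0 : ℝ) 1) : Tendsto (fun n => chain U j n x) atTop (𝓝 0) := by
  have h1 : Tendsto (fun n => ∑ i ∈ Finset.range n, a i) atTop atTop :=
    (not_summable_iff_tendsto_nat_atTop_of_nonneg ha0).1 hasum
  have h2 : Tendsto (fun n => ∑ i ∈ Finset.Ico j n, a i) atTop atTop := by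
    refine (tendsto_atTop_add_const_right _ (-∑ i ∈ Finset.range j, a i) h1).congr' ?_
    filter_upwards [eventually_ge_atTop j] with n hn
    rw [Finset.sum_Ico_eq_sub _ hn, sub_eq_add_neg]
  have h3 : Tendsto (fun n => Real.exp (-∑ i ∈ Finset.Ico j n, a i) * x) atTop (𝓝 0) := by
    simpa using (Real.tendsto_exp_neg_atTop_nhds_zero.comp h2).mul_const x
  exact squeeze_zero (fun n => (chain_mem (contraction_mem ha0 hU0 hU1) j n hx).1)
    (fun n => chain_le_exp ha0 hU0 hU1 j n hx) h3

/-- Errors that are small relative to the decrements along the chains add up to a null sequence. -/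
theorem tendsto_sum_chain {a : ℕ → ℝ} (ha0 : ∀ n, 0 ≤ a n) (hasum : ¬ Summable a)
    (hU0 : ∀ n, ∀ x ∈ Set.Icc (0 : ℝ) 1, 0 ≤ U n x)
    (hU1 : ∀ n, ∀ x ∈ Set.Icc (0 : ℝ) 1, U n x ≤ (1 - a n) * x)
    {w : ℕ → ℝ → ℝ} (hw0 : ∀ n x, 0 ≤ w n x)
    (hw : ∀ n, Tendsto (w n) (𝓝[Set.Icc 0 1] 0) (𝓝 0))
    (hwU : ∀ δ > 0, ∀ᶠ n in atTop, ∀ x ∈ Set.Icc (0 : ℝ) 1, w n x ≤ δ * (x - U n x))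
    {x : ℝ} (hx : x ∈ Set.Icc (0 : ℝ) 1) :
    Tendsto (fun n => ∑ j ∈ Finset.range n, w j (chain U (j + 1) n x)) atTop (𝓝 0) := by
  have hmem := contraction_mem ha0 hU0 hU1
  rw [Metric.tendsto_atTop]
  intro δ hδ
  obtain ⟨J, hJ⟩ := eventually_atTop.1 (hwU (δ / 2) (by positivity))
  -- The bound by decrements is available only from `J` on. The finitely many earlier errors vanish
  -- because their arguments tend to `0`.
  have hhead : Tendsto (fun n => ∑ j ∈ Finset.range J, w j (chain U (j + 1) n x)) atTop
      (𝓝 0) := by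
    rw [← Finset.sum_const_zero (s := Finset.range J)]
    refine tendsto_finsetSum _ fun j _ => (hw j).comp ?_
    rw [tendsto_nhdsWithin_iff]
    exact ⟨chain_tendsto_zero ha0 hasum hU0 hU1 _ hx,
      Eventually.of_forall fun n => chain_mem hmem _ _ hx⟩
  obtain ⟨N, hN⟩ := Metric.tendsto_atTop.1 hhead (δ / 2) (by positivity)
  refine ⟨max N J, fun n hn => ?_⟩
  have hnJ : J ≤ n := le_of_max_le_right hn
  have h1 := hN n (le_of_max_le_left hn)
  rw [Real.dist_0_eq_abs] at h1 ⊢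
  rw [abs_of_nonneg (Finset.sum_nonneg fun _ _ => hw0 _ _)] at h1 ⊢
  rw [← Finset.sum_range_add_sum_Ico _ hnJ]
  -- The decrements telescope along the chain, which stays in `[0, 1]`, so their total is at most
  -- `1`.
  have htail : ∑ j ∈ Finset.Ico J n, w j (chain U (j + 1) n x) ≤ δ / 2 := by
    calc ∑ j ∈ Finset.Ico J n, w j (chain U (j + 1) n x)
        ≤ ∑ j ∈ Finset.Ico J n, δ / 2 * (chain U (j + 1) n x - chain U j n x) := by
          refine Finset.sum_le_sum fun j hj => ?_
          rw [Finset.mem_Ico] at hj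
          rw [chain_eq_apply hj.2]
          exact hJ j hj.1 _ (chain_mem hmem _ _ hx)
      _ = δ / 2 * (chain U n n x - chain U J n x) := by
          rw [← Finset.mul_sum, Finset.sum_Ico_sub (fun j => chain U j n x) hnJ]
      _ ≤ δ / 2 := by
          have := (chain_mem hmem n n hx).2
          have := (chain_mem hmem J n hx).1
          nlinarith
  linarith

/-- Replace the factors one at a time; all the others have modulus at most `1`. -/
theorem abs_prod_sub_prod_le {ι : Type*} (s : Finset ι) {f g : ι → ℝ}
    (hf : ∀ i ∈ s, |f i| ≤ 1) (hg : ∀ i ∈ s, |g i| ≤ 1) :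
    |∏ i ∈ s, f i - ∏ i ∈ s, g i| ≤ ∑ i ∈ s, |f i - g i| := by
  classical
  induction s using Finset.induction_on with
  | empty => simp
  | insert i s hi ih =>
    rw [Finset.prod_insert hi, Finset.prod_insert hi, Finset.sum_insert hi]
    have h1 := ih (fun j hj => hf j (Finset.mem_insert_of_mem hj))
      (fun j hj => hg j (Finset.mem_insert_of_mem hj))
    have h2 : |∏ j ∈ s, f j| ≤ 1 := by
      rw [Finset.abs_prod]
      exact Finset.prod_le_one (fun _ _ => abs_nonneg _)
        fun j hj => hf j (Finset.mem_insert_of_mem hj)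
    have h3 := hg i (Finset.mem_insert_self i s)
    calc |f i * ∏ j ∈ s, f j - g i * ∏ j ∈ s, g j|
        = |(f i - g i) * ∏ j ∈ s, f j + g i * (∏ j ∈ s, f j - ∏ j ∈ s, g j)| := by
          congr 1; ring
      _ ≤ |f i - g i| * |∏ j ∈ s, f j| + |g i| * |∏ j ∈ s, f j - ∏ j ∈ s, g j| := by
          rw [← abs_mul, ← abs_mul]; exact abs_add_le _ _
      _ ≤ |f i - g i| * 1 + 1 * ∑ j ∈ s, |f j - g j| := by gcongr
      _ = _ := by ring

theorem abs_one_sub_sub_exp_neg_le {d : ℝ} (hd : 0 ≤ d) : |1 - d - Real.exp (-d)| ≤ d ^ 2 := by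
  rw [abs_le]
  have h1 := Real.one_sub_le_exp_neg d
  have h2 := Real.exp_le_one_iff.2 (neg_nonpos.2 hd)
  refine ⟨?_, by nlinarith [sq_nonneg d]⟩
  rcases le_or_gt d 1 with h | h
  · have h3 := Real.abs_exp_sub_one_sub_id_le (x := -d) (by rwa [abs_neg, abs_of_nonneg hd])
    have := (abs_le.1 h3).2
    nlinarith
  · nlinarith

/-- The increments of `H` along a chain telescope to `H x - H (chain U 0 n x)`, which tends to `H
x`. The first term of `hest` pays for replacing `V` by these increments `d`, the square for
replacing `1 - d` by `exp (-d)`. Monotonicity of `H` makes `d` nonnegative. -/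
theorem tendsto_sum_and_prod_chain {a : ℕ → ℝ} (ha0 : ∀ n, 0 ≤ a n) (hasum : ¬ Summable a)
    (hU0 : ∀ n, ∀ x ∈ Set.Icc (0 : ℝ) 1, 0 ≤ U n x)
    (hU1 : ∀ n, ∀ x ∈ Set.Icc (0 : ℝ) 1, U n x ≤ (1 - a n) * x)
    {V : ℕ → ℝ → ℝ} (hV : ∀ n, ∀ x ∈ Set.Icc (0 : ℝ) 1, V n x ∈ Set.Icc (0 : ℝ) 1)
    (hV0 : ∀ n, Tendsto (V n) (𝓝[Set.Icc 0 1] 0) (𝓝 0))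
    {H : ℝ → ℝ} (hH0 : H 0 = 0) (hHc : ContinuousOn H (Set.Icc 0 1))
    (hHm : MonotoneOn H (Set.Icc 0 1))
    (hest : ∀ δ > 0, ∀ᶠ n in atTop, ∀ x ∈ Set.Icc (0 : ℝ) 1,
      |V n x - (H x - H (U n x))| + (H x - H (U n x)) ^ 2 ≤ δ * (x - U n x))
    {x : ℝ} (hx : x ∈ Set.Icc (0 : ℝ) 1) :
    Tendsto (fun n => ∑ j ∈ Finset.range n, V j (chain U (j + 1) n x)) atTop (𝓝 (H x)) ∧
    Tendsto (fun n => ∏ j ∈ Finset.range n, (1 - V j (chain U (j + 1) n x))) atTop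
      (𝓝 (Real.exp (-H x))) := by
  have hmem := contraction_mem ha0 hU0 hU1
  have hle : ∀ n, ∀ x ∈ Set.Icc (0 : ℝ) 1, U n x ≤ x := fun n x hx =>
    (hU1 n x hx).trans (by nlinarith [hx.1, ha0 n])
  have hHz : Tendsto H (𝓝[Set.Icc 0 1] 0) (𝓝 0) := by
    simpa [hH0, ContinuousWithinAt] using hHc 0 (by simp)
  have hUz : ∀ n, Tendsto (U n) (𝓝[Set.Icc 0 1] 0) (𝓝[Set.Icc 0 1] 0) := fun n => by
    rw [tendsto_nhdsWithin_iff]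
    refine ⟨?_, eventually_mem_nhdsWithin.mono (hmem n)⟩
    refine tendsto_of_tendsto_of_tendsto_of_le_of_le' tendsto_const_nhds
      (tendsto_nhdsWithin_of_tendsto_nhds tendsto_id)
      (eventually_mem_nhdsWithin.mono (hU0 n)) (eventually_mem_nhdsWithin.mono (hle n))
  set d : ℕ → ℝ → ℝ := fun n x => H x - H (U n x) with hd
  have hdz : ∀ n, Tendsto (d n) (𝓝[Set.Icc 0 1] 0) (𝓝 0) := fun n => by
    simpa using hHz.sub (hHz.comp (hUz n))
  have hw := tendsto_sum_chain (w := fun n x => |V n x - d n x| + d n x ^ 2) ha0 hasum hU0 hU1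
    (fun n x => by positivity)
    (fun n => by simpa using ((hV0 n).sub (hdz n)).abs.add ((hdz n).pow 2)) hest hx
  have hsumd : ∀ n, ∑ j ∈ Finset.range n, d j (chain U (j + 1) n x)
      = H x - H (chain U 0 n x) := fun n => by
    have e : ∑ j ∈ Finset.range n, d j (chain U (j + 1) n x)
        = ∑ j ∈ Finset.range n, (H (chain U (j + 1) n x) - H (chain U j n x)) :=
      Finset.sum_congr rfl fun j hj => by
        rw [hd, chain_eq_apply (j := j) (Finset.mem_range.1 hj)]
    rw [e, Finset.sum_range_sub fun j => H (chain U j n x), chain_of_le le_rfl]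
  have hdlim : Tendsto (fun n => ∑ j ∈ Finset.range n, d j (chain U (j + 1) n x)) atTop
      (𝓝 (H x)) := by
    simp_rw [hsumd]
    have : Tendsto (fun n => H (chain U 0 n x)) atTop (𝓝 0) := hHz.comp <|
      tendsto_nhdsWithin_iff.2 ⟨chain_tendsto_zero ha0 hasum hU0 hU1 _ hx,
        Eventually.of_forall fun n => chain_mem hmem _ _ hx⟩
    simpa using this.const_sub (H x)
  have hd0 : ∀ j n, 0 ≤ d j (chain U (j + 1) n x) := fun j n =>
    sub_nonneg.2 <| hHm (hmem _ _ (chain_mem hmem _ _ hx)) (chain_mem hmem _ _ hx)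
      (hle _ _ (chain_mem hmem _ _ hx))
  constructor
  · refine (tendsto_iff_of_dist (squeeze_zero (fun _ => dist_nonneg) (fun n => ?_) hw)).2 hdlim
    rw [Real.dist_eq, ← Finset.sum_sub_distrib]
    refine (Finset.abs_sum_le_sum_abs _ _).trans (Finset.sum_le_sum fun j _ => ?_)
    exact le_add_of_nonneg_right (sq_nonneg _)
  · have hexp : Tendsto (fun n => ∏ j ∈ Finset.range n, Real.exp (-d j (chain U (j + 1) n x)))
        atTop (𝓝 (Real.exp (-H x))) := by
      simp_rw [← Real.exp_sum, Finset.sum_neg_distrib]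
      exact (Real.continuous_exp.tendsto _).comp hdlim.neg
    refine (tendsto_iff_of_dist (squeeze_zero (fun _ => dist_nonneg) (fun n => ?_) hw)).2 hexp
    rw [Real.dist_eq]
    refine (abs_prod_sub_prod_le _ (fun j _ => ?_) (fun j _ => ?_)).trans
      (Finset.sum_le_sum fun j _ => ?_)
    · have := hV j _ (chain_mem hmem (j + 1) n hx)
      rw [abs_le]; constructor <;> linarith [this.1, this.2]
    · rw [abs_of_nonneg (Real.exp_pos _).le]
      exact Real.exp_le_one_iff.2 (neg_nonpos.2 (hd0 j n))
    · set y := chain U (j + 1) n x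
      calc |1 - V j y - Real.exp (-d j y)|
          = |-(V j y - d j y) + (1 - d j y - Real.exp (-d j y))| := by congr 1; ring
        _ ≤ |-(V j y - d j y)| + |1 - d j y - Real.exp (-d j y)| := abs_add_le _ _
        _ ≤ _ := by rw [abs_neg]; gcongr; exact abs_one_sub_sub_exp_neg_le (hd0 j n)

end Chain

/-! ### Local error estimate for one step of the Riemann sum. -/

/-- The expansion of the offspring and immigration functions at `0` controls the error made by
replacing `V n` by the increments of a primitive of `p x / (1 + r x)`. -/
theorem increment_estimate {a : ℕ → ℝ} (ha0 : ∀ n, 0 < a n) (halim : Tendsto a atTop (𝓝 0))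
    {U V : ℕ → ℝ → ℝ} {r : ℝ} (hr : 0 ≤ r)
    (hU0 : ∀ n, ∀ x ∈ Set.Icc (0 : ℝ) 1, 0 ≤ U n x)
    (hU1 : ∀ n, ∀ x ∈ Set.Icc (0 : ℝ) 1, U n x ≤ (1 - a n) * x)
    (hU2 : ∀ δ > 0, ∀ᶠ n in atTop, ∀ x ∈ Set.Icc (0 : ℝ) 1,
      |x - U n x - a n * (x + r * x ^ 2)| ≤ δ * (a n * x))
    {p : ℝ → ℝ} (hp : Continuous p)
    (hV : ∀ δ > 0, ∀ᶠ n in atTop, ∀ x ∈ Set.Icc (0 : ℝ) 1,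
      |V n x - a n * (x * p x)| ≤ δ * (a n * x))
    {H : ℝ → ℝ} (hH : ∀ x, 0 ≤ x → HasDerivAt H (p x / (1 + r * x)) x)
    {δ : ℝ} (hδ : 0 < δ) :
    ∀ᶠ n in atTop, ∀ x ∈ Set.Icc (0 : ℝ) 1,
      |V n x - (H x - H (U n x))| + (H x - H (U n x)) ^ 2 ≤ δ * (x - U n x) := by
  set h : ℝ → ℝ := fun x => p x / (1 + r * x) with hh
  have hpos : ∀ x ∈ Set.Icc (0 : ℝ) 1, 0 < 1 + r * x := fun x hx => by
    have := mul_nonneg hr hx.1; linarith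
  have hhc : ContinuousOn h (Set.Icc 0 1) :=
    hp.continuousOn.div (by fun_prop) fun x hx => (hpos x hx).ne'
  obtain ⟨M, hM⟩ := isCompact_Icc.exists_bound_of_continuousOn hhc
  simp only [Real.norm_eq_abs] at hM
  have hM0 : 0 ≤ M := (abs_nonneg _).trans (hM 0 (by simp))
  -- `M` bounds the integrand. The error below is at most `δ' * (2 + M)` times the decrement, and
  -- the square at most `δ' * M ^ 2` times it.
  set δ' := δ / (3 + M + M ^ 2) with hδ'
  have hδ'0 : 0 < δ' := by positivity
  obtain ⟨η, hη, hunif⟩ := Metric.uniformContinuousOn_iff.1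
    (isCompact_Icc.uniformContinuousOn_of_continuous hhc) δ' hδ'0
  -- `a n * (2 + r)` bounds the decrement, by `hU2` with tolerance `1`. It must be small both for
  -- uniform continuity of the integrand and for the squared increment.
  have hsmall : ∀ᶠ n in atTop, a n * (2 + r) < min η δ' := by
    have : Tendsto (fun n => a n * (2 + r)) atTop (𝓝 0) := by simpa using halim.mul_const (2 + r)
    exact this.eventually_lt_const (lt_min hη hδ'0)
  filter_upwards [hU2 δ' hδ'0, hV δ' hδ'0, hU2 1 one_pos, hsmall] with n h1 h2 h3 h4 x hx
  have hmem : U n x ∈ Set.Icc (0 : ℝ) 1 := contraction_mem (fun n => (ha0 n).le) hU0 hU1 n x hx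
  have han := ha0 n
  have hlow : a n * x ≤ x - U n x := by linarith [hU1 n x hx]
  have hax : 0 ≤ a n * x := mul_nonneg han.le hx.1
  have hle : U n x ≤ x := by linarith
  have hup : x - U n x ≤ a n * (2 + r) := by
    have := (abs_le.1 (h3 x hx)).2
    have h5 : x ^ 2 ≤ 1 := pow_le_one₀ hx.1 hx.2
    have h6 : a n * x ≤ a n := by nlinarith [hx.2]
    have h7 : a n * (r * x ^ 2) ≤ a n * r := by
      refine mul_le_mul_of_nonneg_left ?_ han.le
      nlinarith
    linarith
  have hupη : x - U n x < η := by linarith [(lt_min_iff.1 h4).1]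
  have hupδ : x - U n x < δ' := by linarith [(lt_min_iff.1 h4).2]
  -- Mean value theorem; the case of a vanishing decrement has to be split off.
  obtain ⟨c, hc, hcd⟩ : ∃ c ∈ Set.Icc (U n x) x, H x - H (U n x) = h c * (x - U n x) := by
    rcases hle.eq_or_lt with he | hlt
    · exact ⟨x, ⟨hle, le_rfl⟩, by rw [he]; ring⟩
    · obtain ⟨c, hc, hc'⟩ := exists_hasDerivAt_eq_slope H h hlt
        (fun y hy => (hH y (hmem.1.trans hy.1)).continuousAt.continuousWithinAt)
        (fun y hy => hH y (hmem.1.trans hy.1.le))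
      refine ⟨c, Set.Ioo_subset_Icc_self hc, ?_⟩
      rw [hc', div_mul_cancel₀ _ (sub_pos.2 hlt).ne']
  have hcm : c ∈ Set.Icc (0 : ℝ) 1 := ⟨hmem.1.trans hc.1, hc.2.trans hx.2⟩
  have hcx : |h c - h x| ≤ δ' := by
    refine (hunif c hcm x hx ?_).le
    rw [Real.dist_eq, abs_sub_comm, abs_of_nonneg (by linarith [hc.2])]
    linarith [hc.1]
  have hD : 0 ≤ x - U n x := by linarith
  have hkey : |V n x - (H x - H (U n x))| ≤ δ' * (2 + M) * (x - U n x) := by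
    -- The integrand is chosen so that it times the leading term of the decrement is exactly the
    -- leading term of `V n x`.
    have e1 : a n * (x * p x) = h x * (a n * (x + r * x ^ 2)) := by
      have := (hpos x hx).ne'
      change a n * (x * p x) = p x / (1 + r * x) * _
      rw [div_mul_eq_mul_div, eq_div_iff this]
      ring
    have e2 : V n x - (H x - H (U n x)) = (V n x - a n * (x * p x))
        + (-(h x * (x - U n x - a n * (x + r * x ^ 2))) + -((h c - h x) * (x - U n x))) := by
      rw [hcd, e1]; ring
    rw [e2]
    have t1 := h2 x hx
    have t2 : |-(h x * (x - U n x - a n * (x + r * x ^ 2)))| ≤ M * (δ' * (a n * x)) := by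
      rw [abs_neg, abs_mul]
      exact mul_le_mul (hM x hx) (h1 x hx) (abs_nonneg _) hM0
    have t3 : |-((h c - h x) * (x - U n x))| ≤ δ' * (x - U n x) := by
      rw [abs_neg, abs_mul, abs_of_nonneg hD]
      exact mul_le_mul_of_nonneg_right hcx hD
    have t4 : δ' * (a n * x) ≤ δ' * (x - U n x) := mul_le_mul_of_nonneg_left hlow hδ'0.le
    have t5 := mul_le_mul_of_nonneg_left t4 hM0
    refine (abs_add_le _ _).trans ((add_le_add le_rfl (abs_add_le _ _)).trans ?_)
    linarith
  have hsq : (H x - H (U n x)) ^ 2 ≤ M ^ 2 * δ' * (x - U n x) := by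
    rw [hcd, mul_pow, mul_assoc]
    refine mul_le_mul ?_ ?_ (sq_nonneg _) (sq_nonneg _)
    · rw [← sq_abs]; exact pow_le_pow_left₀ (abs_nonneg _) (hM c hcm) 2
    · rw [sq]; exact mul_le_mul_of_nonneg_right hupδ.le hD
  calc _ ≤ δ' * (2 + M) * (x - U n x) + M ^ 2 * δ' * (x - U n x) := add_le_add hkey hsq
    _ ≤ δ' * (3 + M + M ^ 2) * (x - U n x) := by
      have := mul_nonneg hδ'0.le hD
      linarith
    _ = δ * (x - U n x) := by rw [hδ', div_mul_cancel₀ _ (by positivity)]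

/-! ### Bonferroni inequalities. -/

/-- The Bonferroni inequalities for the binomial expansion of `(1 - x) ^ m`. -/
theorem bonferroni_nonneg {x : ℝ} (hx : x ∈ Set.Icc (0 : ℝ) 1) (m k : ℕ) :
    0 ≤ (-1) ^ k * ((1 - x) ^ m - ∑ i ∈ Finset.range k, (m.choose i : ℝ) * (-x) ^ i) := by
  induction m generalizing k with
  | zero =>
    cases k with
    | zero => simp
    | succ k => simp [Finset.sum_range_succ']
  | succ m ih =>
    cases k with
    | zero => simpa using pow_nonneg (sub_nonneg.2 hx.2) _
    | succ k =>
      have h1 := ih (k + 1)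
      have h2 := mul_nonneg hx.1 (ih k)
      -- By Pascal's rule the remainders satisfy `R (m+1) (k+1) = R m (k+1) - x * R m k`; after
      -- multiplication by the sign both terms are nonnegative.
      have e : ∑ i ∈ Finset.range (k + 1), ((m + 1).choose i : ℝ) * (-x) ^ i
          = ∑ i ∈ Finset.range (k + 1), (m.choose i : ℝ) * (-x) ^ i
            + (-x) * ∑ i ∈ Finset.range k, (m.choose i : ℝ) * (-x) ^ i := by
        rw [Finset.sum_range_succ', Finset.sum_range_succ' _ k, Finset.mul_sum]
        simp only [Nat.choose_succ_succ, Nat.cast_add, Nat.choose_zero_right, add_mul,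
          Finset.sum_add_distrib, pow_succ]
        have : ∀ i, (m.choose i : ℝ) * ((-x) ^ i * -x) = -x * ((m.choose i : ℝ) * (-x) ^ i) :=
          fun i => by ring
        simp only [this, ← Finset.mul_sum]
        ring
      rw [e]
      rw [pow_succ] at h1 ⊢
      linear_combination h1 + h2

/-- Consecutive remainders have opposite signs, so each is at most the first omitted term. -/
theorem bonferroni_abs_le {x : ℝ} (hx : x ∈ Set.Icc (0 : ℝ) 1) (m k : ℕ) :
    |(1 - x) ^ m - ∑ i ∈ Finset.range k, (m.choose i : ℝ) * (-x) ^ i| ≤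
      (m.choose k : ℝ) * x ^ k := by
  have h1 := bonferroni_nonneg hx m k
  have h2 := bonferroni_nonneg hx m (k + 1)
  rw [Finset.sum_range_succ, pow_succ] at h2
  have e : (-x) ^ k = (-1) ^ k * x ^ k := by rw [← mul_pow]; simp
  have e2 : ((-1 : ℝ) ^ k) * (-1) ^ k = 1 := by rw [← mul_pow]; simp
  set R := (1 - x) ^ m - ∑ i ∈ Finset.range k, (m.choose i : ℝ) * (-x) ^ i with hR
  have h3 : |R| = (-1) ^ k * R := by
    rw [← abs_of_nonneg h1, abs_mul, abs_pow]; simp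
  rw [h3]
  have h4 : (-1) ^ k * -1 * ((1 - x) ^ m - (∑ i ∈ Finset.range k, (m.choose i : ℝ) * (-x) ^ i +
      (m.choose k : ℝ) * (-x) ^ k)) = (m.choose k : ℝ) * x ^ k - (-1) ^ k * R := by
    rw [e, hR]; linear_combination (m.choose k : ℝ) * x ^ k * e2
  linarith

/-! ### Power series with bounded coefficients: uniqueness, selection, Abel summation. -/

theorem summable_bounded_mul_pow {c : ℕ → ℝ} {C s : ℝ} (hc : ∀ k, |c k| ≤ C)
    (hs : s ∈ Set.Ico (0 : ℝ) 1) : Summable fun k => c k * s ^ k := by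
  refine Summable.of_norm_bounded ((summable_geometric_of_lt_one hs.1 hs.2).mul_left C)
    fun k => ?_
  rw [norm_mul, norm_pow, Real.norm_eq_abs, Real.norm_of_nonneg hs.1]
  exact mul_le_mul_of_nonneg_right (hc k) (pow_nonneg hs.1 k)

/-- Once the lower coefficients vanish, divide by `s ^ k` and let `s` decrease to `0`. -/
theorem eq_zero_of_tsum_mul_pow_eq_zero {c : ℕ → ℝ} {C : ℝ} (hc : ∀ k, |c k| ≤ C)
    (h : ∀ s ∈ Set.Ioo (0 : ℝ) 1, ∑' k, c k * s ^ k = 0) (k : ℕ) : c k = 0 := by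
  induction k using Nat.strong_induction_on with
  | _ k ih =>
    have key : ∀ s ∈ Set.Ioo (0 : ℝ) 1, c k = -s * ∑' i, c (k + 1 + i) * s ^ i := fun s hs => by
      have h1 := (summable_bounded_mul_pow hc ⟨hs.1.le, hs.2⟩).sum_add_tsum_nat_add (k + 1)
      rw [h s hs, Finset.sum_range_succ, Finset.sum_eq_zero (fun i hi => by
        rw [ih i (Finset.mem_range.1 hi), zero_mul]), zero_add] at h1
      have h2 : ∑' i, c (i + (k + 1)) * s ^ (i + (k + 1))
          = s ^ k * (s * ∑' i, c (k + 1 + i) * s ^ i) := by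
        rw [← tsum_mul_left, ← tsum_mul_left]
        exact tsum_congr fun i => by rw [add_comm i]; ring
      rw [h2, mul_comm, ← mul_add] at h1
      have := (mul_eq_zero.1 h1).resolve_left (pow_pos hs.1 k).ne'
      linarith
    have hbound : ∀ s ∈ Set.Ioo (0 : ℝ) 1, |c k| ≤ s * (C * (1 - s)⁻¹) := fun s hs => by
      have h1 : |∑' i, c (k + 1 + i) * s ^ i| ≤ C * (1 - s)⁻¹ := by
        rw [← Real.norm_eq_abs]
        refine tsum_of_norm_bounded ((hasSum_geometric_of_lt_one hs.1.le hs.2).mul_left C)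
          fun i => ?_
        rw [norm_mul, norm_pow, Real.norm_eq_abs, Real.norm_of_nonneg hs.1.le]
        exact mul_le_mul_of_nonneg_right (hc _) (pow_nonneg hs.1.le i)
      rw [key s hs, abs_mul, abs_neg, abs_of_pos hs.1]
      exact mul_le_mul_of_nonneg_left h1 hs.1.le
    have hlim : Tendsto (fun s : ℝ => s * (C * (1 - s)⁻¹)) (𝓝[>] 0) (𝓝 0) := by
      have : ContinuousAt (fun s : ℝ => s * (C * (1 - s)⁻¹)) 0 :=
        continuousAt_id.mul (continuousAt_const.mul
          ((continuousAt_const.sub continuousAt_id).inv₀ (by simp)))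
      simpa using this.tendsto.mono_left nhdsWithin_le_nhds
    have : |c k| ≤ 0 := ge_of_tendsto hlim <| by
      filter_upwards [Ioo_mem_nhdsGT (zero_lt_one' ℝ)] with s hs using hbound s hs
    exact abs_eq_zero.1 (le_antisymm this (abs_nonneg _))

/-- A selection theorem for power series with uniformly bounded nonnegative coefficients. -/
theorem exists_subseq_tendsto_coeff {b : ℕ → ℕ → ℝ} {C : ℝ}
    (hb : ∀ n k, b n k ∈ Set.Icc 0 C) {ψ : ℝ → ℝ}
    (h : ∀ s ∈ Set.Ico (0 : ℝ) 1, Tendsto (fun n => ∑' k, b n k * s ^ k) atTop (𝓝 (ψ s))) :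
    ∃ (c : ℕ → ℝ) (φ : ℕ → ℕ), (∀ k, c k ∈ Set.Icc 0 C) ∧
      (∀ k, Tendsto (fun n => b (φ n) k) atTop (𝓝 (c k))) ∧
      ∀ s ∈ Set.Ico (0 : ℝ) 1, ∑' k, c k * s ^ k = ψ s := by
  -- The cube `[0, C]^ℕ` is sequentially compact in the product topology. Dominated convergence then
  -- carries the series to the limit for each fixed `s < 1`.
  obtain ⟨c, hc, φ, hφ, hlim⟩ := (isCompact_univ_pi fun _ : ℕ =>
    isCompact_Icc (a := (0 : ℝ)) (b := C)).tendsto_subseq (x := b) fun n k _ => hb n k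
  rw [tendsto_pi_nhds] at hlim
  refine ⟨c, φ, fun k => hc k trivial, hlim, fun s hs => ?_⟩
  refine tendsto_nhds_unique ?_ ((h s hs).comp hφ.tendsto_atTop)
  refine tendsto_tsum_of_dominated_convergence
    ((summable_geometric_of_lt_one hs.1 hs.2).mul_left C)
    (fun k => (hlim k).mul_const _) (Eventually.of_forall fun n k => ?_)
  rw [norm_mul, norm_pow, Real.norm_of_nonneg (hb _ k).1, Real.norm_of_nonneg hs.1]
  exact mul_le_mul_of_nonneg_right (hb _ k).2 (pow_nonneg hs.1 k)

/-- Every subsequence has a further subsequence with convergent coefficients, and uniqueness of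
power series identifies the limit. -/
theorem tendsto_coeff {b : ℕ → ℕ → ℝ} {c : ℕ → ℝ} {C : ℝ}
    (hb : ∀ n k, b n k ∈ Set.Icc 0 C) (hc : ∀ k, c k ∈ Set.Icc 0 C)
    (h : ∀ s ∈ Set.Ico (0 : ℝ) 1,
      Tendsto (fun n => ∑' k, b n k * s ^ k) atTop (𝓝 (∑' k, c k * s ^ k))) (k : ℕ) :
    Tendsto (fun n => b n k) atTop (𝓝 (c k)) := by
  refine tendsto_of_subseq_tendsto fun ns hns => ?_
  obtain ⟨c', φ, hc', hlim, hψ⟩ := exists_subseq_tendsto_coeff (fun n => hb (ns n))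
    fun s hs => (h s hs).comp hns
  refine ⟨φ, ?_⟩
  have hab : ∀ {f : ℕ → ℝ}, (∀ k, f k ∈ Set.Icc 0 C) → ∀ k, |f k| ≤ C := fun hf k => by
    rw [abs_of_nonneg (hf k).1]; exact (hf k).2
  have := eq_zero_of_tsum_mul_pow_eq_zero (c := fun k => c' k - c k) (C := C) (fun k => by
    rw [abs_le]; constructor <;> linarith [(hc k).1, (hc k).2, (hc' k).1, (hc' k).2])
    (fun s hs => by
      simp_rw [sub_mul]
      have hs' : s ∈ Set.Ico (0 : ℝ) 1 := ⟨hs.1.le, hs.2⟩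
      rw [(summable_bounded_mul_pow (hab hc') hs').tsum_sub
        (summable_bounded_mul_pow (hab hc) hs'), hψ s hs', sub_self]) k
  rw [← sub_eq_zero.1 this]
  exact hlim k

/-- Abel summation at `1` for nonnegative coefficients. -/
theorem hasSum_coeff_of_tendsto {c : ℕ → ℝ} {C : ℝ} (hc : ∀ k, c k ∈ Set.Icc 0 C) {ψ : ℝ → ℝ}
    (h : ∀ s ∈ Set.Ico (0 : ℝ) 1, ∑' k, c k * s ^ k = ψ s)
    (hψ : ContinuousWithinAt ψ (Set.Iio 1) 1) : HasSum c (ψ 1) := by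
  have hev : Set.Ioo (0 : ℝ) 1 ∈ 𝓝[<] (1 : ℝ) := Ioo_mem_nhdsLT zero_lt_one
  have hsum : ∀ s ∈ Set.Ioo (0 : ℝ) 1, Summable fun k => c k * s ^ k := fun s hs =>
    summable_bounded_mul_pow (C := C) (fun k => by rw [abs_of_nonneg (hc k).1]; exact (hc k).2)
      ⟨hs.1.le, hs.2⟩
  have hpart : ∀ N, ∑ k ∈ Finset.range N, c k ≤ ψ 1 := fun N => by
    have hcont : Tendsto (fun s : ℝ => ∑ k ∈ Finset.range N, c k * s ^ k) (𝓝[<] 1)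
        (𝓝 (∑ k ∈ Finset.range N, c k)) := by
      have : Continuous fun s : ℝ => ∑ k ∈ Finset.range N, c k * s ^ k := by fun_prop
      simpa using (this.tendsto 1).mono_left nhdsWithin_le_nhds
    refine le_of_tendsto_of_tendsto hcont hψ ?_
    filter_upwards [hev] with s hs
    rw [← h s ⟨hs.1.le, hs.2⟩]
    exact (hsum s hs).sum_le_tsum _ fun k _ => mul_nonneg (hc k).1 (pow_nonneg hs.1.le k)
  have hs := summable_of_sum_range_le (fun k => (hc k).1) hpart
  have h1 : ∑' k, c k ≤ ψ 1 := hs.tsum_le_of_sum_range_le hpart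
  have h2 : ψ 1 ≤ ∑' k, c k := by
    refine le_of_tendsto hψ ?_
    filter_upwards [hev] with s hs'
    rw [← h s ⟨hs'.1.le, hs'.2⟩]
    exact (hsum s hs').tsum_le_tsum
      (fun k => mul_le_of_le_one_right (hc k).1 (pow_le_one₀ hs'.1.le hs'.2.le)) hs
  rw [← le_antisymm h1 h2]
  exact hs.hasSum

/-! ### Generating functions, convergence in distribution and compound-Poisson laws. -/

section GeneratingFunction

variable {Ω : Type*} [MeasurableSpace Ω] {P : Measure Ω} [IsProbabilityMeasure P]

theorem integrable_pow {X : Ω → ℕ} (hX : Measurable X) {s : ℝ} (hs : s ∈ Set.Icc (0 : ℝ) 1) :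
    Integrable (fun ω => s ^ X ω) P := by
  refine Integrable.of_bound ((measurable_of_countable fun k : ℕ => s ^ k).comp
    hX).aestronglyMeasurable 1 (ae_of_all _ fun ω => ?_)
  rw [norm_pow, Real.norm_of_nonneg hs.1]
  exact pow_le_one₀ hs.1 hs.2

theorem integral_pow_mem {X : Ω → ℕ} (hX : Measurable X) {s : ℝ} (hs : s ∈ Set.Icc (0 : ℝ) 1) :
    ∫ ω, s ^ X ω ∂P ∈ Set.Icc (0 : ℝ) 1 := by
  refine ⟨integral_nonneg fun ω => pow_nonneg hs.1 _, ?_⟩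
  simpa using integral_mono (μ := P) (integrable_pow hX hs) (integrable_const (1 : ℝ))
    fun ω => pow_le_one₀ hs.1 hs.2

theorem hasSum_integral_pow {X : Ω → ℕ} (hX : Measurable X) {s : ℝ}
    (hs : s ∈ Set.Icc (0 : ℝ) 1) :
    HasSum (fun k => P.real (X ⁻¹' {k}) * s ^ k) (∫ ω, s ^ X ω ∂P) := by
  have := Measure.isProbabilityMeasure_map (μ := P) hX.aemeasurable
  have hint : Integrable (fun k : ℕ => s ^ k) (P.map X) :=
    integrable_pow (P := P.map X) measurable_id hs
  have h1 : ∫ ω, s ^ X ω ∂P = ∫ k, s ^ k ∂(P.map X) :=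
    (integral_map hX.aemeasurable (measurable_of_countable _).aestronglyMeasurable).symm
  have h2 : ∀ k, P.real (X ⁻¹' {k}) * s ^ k = (P.map X).real {k} * s ^ k := fun k => by
    rw [map_measureReal_apply hX (measurableSet_singleton k)]
  rw [h1, integral_countable hint]
  simp_rw [h2, ← smul_eq_mul]
  refine Summable.hasSum ?_
  simp_rw [smul_eq_mul, ← h2]
  refine Summable.of_nonneg_of_le (fun k => mul_nonneg measureReal_nonneg (pow_nonneg hs.1 k))
    (fun k => mul_le_of_le_one_right measureReal_nonneg (pow_le_one₀ hs.1 hs.2)) ?_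
  have h3 : ∑' k, (P.map X) {k} ≠ ∞ := by
    have := Measure.tsum_indicator_apply_singleton (P.map X) Set.univ MeasurableSet.univ
    simp only [Set.indicator_univ, measure_univ] at this
    simp [this]
  simpa [measureReal_def, Measure.map_apply hX] using ENNReal.summable_toReal h3

/-- Convergence of generating functions on `[0, 1)` implies convergence in distribution. -/
theorem tendstoInDistribution_of_tendsto_integral_pow {X : ℕ → Ω → ℕ}
    (hX : ∀ n, Measurable (X n)) {μ : Measure ℕ} [IsProbabilityMeasure μ]
    (h : ∀ s ∈ Set.Ico (0 : ℝ) 1,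
      Tendsto (fun n => ∫ ω, s ^ X n ω ∂P) atTop (𝓝 (∫ y, s ^ y ∂μ))) :
    TendstoInDistribution X atTop (id : ℕ → ℕ) (fun _ => P) μ where
  forall_aemeasurable n := (hX n).aemeasurable
  aemeasurable_limit := measurable_id.aemeasurable
  tendsto := by
    have hIcc : ∀ s ∈ Set.Ico (0 : ℝ) 1, s ∈ Set.Icc (0 : ℝ) 1 := fun s hs => ⟨hs.1, hs.2.le⟩
    have hreal : ∀ k, Tendsto (fun n => P.real (X n ⁻¹' {k})) atTop (𝓝 (μ.real {k})) := by
      refine tendsto_coeff (C := 1) (fun n k => ⟨measureReal_nonneg, measureReal_le_one⟩)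
        (fun k => ⟨measureReal_nonneg, measureReal_le_one⟩) fun s hs => ?_
      have h1 := h s hs
      have h2 : ∫ y, s ^ y ∂μ = ∑' k, μ.real {k} * s ^ k :=
        (hasSum_integral_pow (P := μ) measurable_id (hIcc s hs)).tsum_eq.symm
      rw [h2] at h1
      refine h1.congr fun n => (hasSum_integral_pow (hX n) (hIcc s hs)).tsum_eq.symm
    have hmass : ∀ k, Tendsto (fun n => (P.map (X n)) {k}) atTop (𝓝 (μ {k})) := fun k => by
      rw [← ENNReal.tendsto_toReal_iff (fun n => ?_) (measure_ne_top _ _)]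
      · simpa [measureReal_def, Measure.map_apply (hX _)] using hreal k
      · rw [Measure.map_apply (hX _) (measurableSet_singleton _)]
        exact measure_ne_top _ _
    -- The portmanteau criterion on open sets follows from convergence of the point masses by
    -- Fatou's lemma for the counting measure.
    refine tendsto_of_forall_isOpen_le_liminf' fun G _ => ?_
    simp only [ProbabilityMeasure.coe_mk, Measure.map_id]
    have hG : ∀ ρ : Measure ℕ, ρ G = ∫⁻ k, G.indicator (fun k => ρ {k}) k ∂Measure.count :=
      fun ρ => by
        rw [lintegral_count]
        exact (Measure.tsum_indicator_apply_singleton ρ G .of_discrete).symm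
    simp_rw [hG]
    refine le_trans (le_of_eq ?_) (lintegral_liminf_le fun n => measurable_of_countable _)
    refine lintegral_congr fun k => ?_
    by_cases hk : k ∈ G
    · simp only [Set.indicator_of_mem hk]
      exact (hmass k).liminf_eq.symm
    · simp [Set.indicator_of_notMem hk]

/-- The generating function of a compound-Poisson law. -/
theorem integral_pow_compoundPoisson (θ : ℝ≥0) (Q : Measure ℕ) [IsProbabilityMeasure Q] {s : ℝ}
    (hs : s ∈ Set.Icc (0 : ℝ) 1) :
    ∫ y, s ^ y ∂(compoundPoisson θ Q) = Real.exp (-(θ * (1 - ∫ y, s ^ y ∂Q))) := by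
  have hsum : ∀ N, Measurable fun z : ℕ → ℕ => ∑ i ∈ Finset.range N, z i := fun N =>
    Finset.measurable_sum _ fun i _ => measurable_pi_apply i
  have hmeas : Measurable fun p : ℕ × (ℕ → ℕ) => ∑ i ∈ Finset.range p.1, p.2 i :=
    measurable_from_prod_countable_right hsum
  rw [compoundPoisson, integral_map hmeas.aemeasurable
    (measurable_of_countable _).aestronglyMeasurable, integral_prod _ (integrable_pow hmeas hs)]
  have hinner : ∀ N : ℕ, ∫ z : ℕ → ℕ, s ^ (∑ i ∈ Finset.range N, z i)
      ∂(Measure.infinitePi fun _ => Q) = (∫ y, s ^ y ∂Q) ^ N := fun N => by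
    have hind : iIndepFun (fun (i : Fin N) (z : ℕ → ℕ) => z i) (Measure.infinitePi fun _ => Q) :=
      (iIndepFun_infinitePi (P := fun _ : ℕ => Q) (X := fun _ ω => ω)
        fun _ => measurable_id).precomp (g := fun i : Fin N => (i : ℕ)) Fin.val_injective
    have := hind.integral_fun_prod_comp (f := fun _ k => s ^ k)
      (fun i => (measurable_pi_apply (i : ℕ)).aemeasurable)
      (fun i => (measurable_of_countable _).aestronglyMeasurable)
    have hcoord : ∀ i : ℕ, ∫ z : ℕ → ℕ, s ^ z i ∂(Measure.infinitePi fun _ => Q)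
        = ∫ y, s ^ y ∂Q := fun i => by
      rw [← integral_map (f := fun k => s ^ k) (measurable_pi_apply i).aemeasurable
        (measurable_of_countable _).aestronglyMeasurable, Measure.infinitePi_map_eval]
    simp only [hcoord, Finset.prod_const, Finset.card_univ, Fintype.card_fin] at this
    rw [← this]
    refine integral_congr_ae (ae_of_all _ fun z => ?_)
    simp only
    rw [← Finset.prod_pow_eq_pow_sum, Finset.prod_range]
  simp only [hinner]
  have hq := integral_pow_mem (P := Q) measurable_id hs
  have h1 := hasSum_integral_poissonMeasure (r := θ)
    (integrable_pow (P := poissonMeasure θ) measurable_id hq)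
  refine h1.unique ?_
  have h2 := (NormedSpace.expSeries_div_hasSum_exp ((θ : ℝ) * ∫ y, s ^ y ∂Q)).mul_left
    (Real.exp (-θ))
  rw [← Real.exp_eq_exp_ℝ, ← Real.exp_add] at h2
  convert! h2 using 1
  · funext n
    simp only [id, smul_eq_mul, mul_pow]
    ring
  · congr 1; ring

/-- If `ψ` is a limit on `[0, 1)` of power series with bounded nonnegative coefficients and is
left-continuous at `1`, then `exp (ψ - ψ 1)` is a compound-Poisson generating function. -/
theorem exists_compoundPoisson {b : ℕ → ℕ → ℝ} {C : ℝ}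
    (hb : ∀ n k, b n k ∈ Set.Icc 0 C) {ψ : ℝ → ℝ} (hψ : ContinuousWithinAt ψ (Set.Iio 1) 1)
    (h : ∀ s ∈ Set.Ico (0 : ℝ) 1, Tendsto (fun n => ∑' k, b n k * s ^ k) atTop (𝓝 (ψ s))) :
    ∃ (θ : ℝ≥0) (Q : Measure ℕ) (_ : IsProbabilityMeasure Q), ∀ s ∈ Set.Icc (0 : ℝ) 1,
      ∫ y, s ^ y ∂(compoundPoisson θ Q) = Real.exp (ψ s - ψ 1) := by
  obtain ⟨c, φ, hc, -, hcψ⟩ := exists_subseq_tendsto_coeff hb h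
  have hsum := hasSum_coeff_of_tendsto hc hcψ hψ
  have hval : ∀ s ∈ Set.Icc (0 : ℝ) 1, ∑' k, c k * s ^ k = ψ s := fun s hs => by
    rcases hs.2.eq_or_lt with rfl | hlt
    · simpa using hsum.tsum_eq
    · exact hcψ s ⟨hs.1, hlt⟩
  have hψ0 : 0 ≤ ψ 1 := hsum.nonneg fun k => (hc k).1
  rcases hψ0.eq_or_lt with h0 | hpos
  -- No normalization is possible when the total mass `ψ 1` vanishes. All coefficients are then `0`,
  -- and the parameter `0` works with any `Q`.
  · have hc0 : ∀ k, c k = 0 := fun k =>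
      congrFun ((hasSum_zero_iff_of_nonneg fun k => (hc k).1).1 (h0 ▸ hsum)) k
    refine ⟨0, Measure.dirac 0, inferInstance, fun s hs => ?_⟩
    rw [integral_pow_compoundPoisson _ _ hs, ← hval s hs, ← h0]
    simp [hc0]
  · have hQ1 : HasSum (fun k => c k / ψ 1) 1 := by
      simpa [hpos.ne'] using hsum.div_const (ψ 1)
    have hQ0 : ∀ k, 0 ≤ c k / ψ 1 := fun k => div_nonneg (hc k).1 hψ0
    set Q : Measure ℕ := Measure.sum fun k => ENNReal.ofReal (c k / ψ 1) • Measure.dirac k with hQ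
    have hprob : IsProbabilityMeasure Q := hQ1.isProbabilityMeasure_sum_dirac hQ0
    refine ⟨(ψ 1).toNNReal, Q, hprob, fun s hs => ?_⟩
    rw [integral_pow_compoundPoisson _ _ hs, Real.coe_toNNReal _ hψ0]
    have hmass : ∀ k, Q.real {k} = c k / ψ 1 := fun k => by
      rw [measureReal_def, hQ, Measure.sum_smul_dirac_singleton, ENNReal.toReal_ofReal (hQ0 k)]
    have h1 := (hasSum_integral_pow (P := Q) measurable_id hs).tsum_eq
    simp only [Set.preimage_id, hmass, id] at h1
    rw [← h1]
    have h2 : ∑' k, c k / ψ 1 * s ^ k = ψ s / ψ 1 := by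
      rw [← hval s hs, ← tsum_div_const]
      exact tsum_congr fun k => by ring
    rw [h2]
    congr 1
    field_simp
    ring

end GeneratingFunction

/-! ### Independence of the generations and the recursion for the generating functions. -/

theorem measurable_random_sum {Ω : Type*} [MeasurableSpace Ω] {Y : Ω → ℕ} {X : ℕ → Ω → ℕ}
    (hY : Measurable Y) (hX : ∀ j, Measurable (X j)) :
    Measurable fun ω => ∑ j ∈ Finset.range (Y ω), X j ω := by
  have : Measurable fun p : ℕ × Ω => ∑ j ∈ Finset.range p.1, X j p.2 :=
    measurable_from_prod_countable_right fun N =>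
      Finset.measurable_sum (Finset.range N) fun j _ => hX j
  exact this.comp (hY.prodMk measurable_id)

section Generations

variable {Ω : Type*} [MeasurableSpace Ω] {P : Measure Ω} {ξ : ℕ → ℕ → Ω → ℕ} {ε : ℕ → Ω → ℕ}

theorem measurable_process (hξ : ∀ n j, Measurable (ξ n j)) (hε : ∀ n, Measurable (ε n)) (n : ℕ) :
    Measurable (processWithImmigration ξ ε n) := by
  induction n with
  | zero => exact measurable_const
  | succ n ih => exact (measurable_random_sum ih (hξ n)).add (hε n)

theorem process_congr {Ω : Type*} {ξ ξ' : ℕ → ℕ → Ω → ℕ} {ε ε' : ℕ → Ω → ℕ} {n : ℕ}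
    (hξ : ∀ i < n, ∀ j, ξ i j = ξ' i j) (hε : ∀ i < n, ε i = ε' i) :
    processWithImmigration ξ ε n = processWithImmigration ξ' ε' n := by
  induction n with
  | zero => rfl
  | succ n ih =>
    funext ω
    simp only [processWithImmigration, ih (fun i hi => hξ i (by omega)) fun i hi => hε i (by omega),
      hξ n (by omega), hε n (by omega)]

/-- The σ-algebra generated by one of the input variables. -/
@[reducible]
def inputSigma (ξ : ℕ → ℕ → Ω → ℕ) (ε : ℕ → Ω → ℕ) (i : (ℕ × ℕ) ⊕ ℕ) : MeasurableSpace Ω :=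
  MeasurableSpace.comap (Sum.elim (fun p : ℕ × ℕ => ξ p.1 p.2) ε i) ⊤

/-- The indices of the input variables of generation `n`. -/
def generation : (ℕ × ℕ) ⊕ ℕ → ℕ := Sum.elim Prod.fst id

theorem measurable_process_past {Ω : Type*} {ξ : ℕ → ℕ → Ω → ℕ} {ε : ℕ → Ω → ℕ} (n : ℕ) :
    Measurable[⨆ i ∈ {i | generation i < n}, inputSigma ξ ε i]
      (processWithImmigration ξ ε n) := by
  have hle : ∀ i, generation i < n → inputSigma ξ ε i ≤
      ⨆ i ∈ {i | generation i < n}, inputSigma ξ ε i := fun i hi => le_biSup (inputSigma ξ ε) hi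
  -- Inputs from generation `n` on do not affect the population; once set to `0`, all inputs are
  -- measurable for the σ-algebra of the past.
  have h1 : processWithImmigration ξ ε n = processWithImmigration
      (fun i j => if i < n then ξ i j else 0) (fun i => if i < n then ε i else 0) n :=
    process_congr (fun i hi j => by rw [if_pos hi]) fun i hi => by rw [if_pos hi]
  rw [h1]
  refine @measurable_process Ω (_) _ _ (fun i j => ?_) (fun i => ?_) n
  · split_ifs with hi
    · exact Measurable.mono (comap_measurable (ξ i j)) (hle (Sum.inl (i, j)) hi) le_rfl
    · exact measurable_const
  · split_ifs with hi
    · exact Measurable.mono (comap_measurable (ε i)) (hle (Sum.inr i) hi) le_rfl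
    · exact measurable_const

/-- The population is a function of inputs of generations below `n`, and disjoint blocks of
independent inputs generate independent σ-algebras. -/
theorem IsBranchingInput.indepFun_process (hinput : IsBranchingInput P ξ ε) (n : ℕ) :
    IndepFun (processWithImmigration ξ ε n) (fun ω => (fun j => ξ n j ω, ε n ω)) P := by
  have hle : ∀ i, inputSigma ξ ε i ≤ ‹MeasurableSpace Ω› := by
    rintro (⟨i, j⟩ | i)
    · exact (hinput.measurable_offspring i j).comap_le
    · exact (hinput.measurable_immigration i).comap_le
  have hdisj : Disjoint {i | generation i < n} {i | generation i = n} :=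
    Set.disjoint_left.2 fun i hi hi' => (Nat.ne_of_lt hi) hi'
  have hind := indep_iSup_of_disjoint hle (iIndepFun.iIndep hinput.indep) hdisj
  refine indep_of_indep_of_le_left (indep_of_indep_of_le_right hind ?_)
    (measurable_process_past n).comap_le
  have hle' : ∀ i, generation i = n → inputSigma ξ ε i ≤
      ⨆ i ∈ {i | generation i = n}, inputSigma ξ ε i := fun i hi => le_biSup (inputSigma ξ ε) hi
  refine Measurable.comap_le ?_
  refine @Measurable.prodMk _ _ _ _ _ (_) _ _ ?_ ?_
  · refine @measurable_pi_lambda _ _ _ (_) _ _ fun j => ?_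
    exact Measurable.mono (comap_measurable (ξ n j)) (hle' (Sum.inl (n, j)) rfl) le_rfl
  · exact Measurable.mono (comap_measurable (ε n)) (hle' (Sum.inr n) rfl) le_rfl

theorem IsBranchingInput.integral_pow_generation [IsProbabilityMeasure P]
    (hinput : IsBranchingInput P ξ ε) (n N : ℕ) (s : ℝ) :
    ∫ ω, s ^ ((∑ j ∈ Finset.range N, ξ n j ω) + ε n ω) ∂P =
      (∫ ω, s ^ ξ n 0 ω ∂P) ^ N * ∫ ω, s ^ ε n ω ∂P := by
  -- `none` stands for the immigrants, `some j` for the offspring of individual `j`, so that one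
  -- product formula covers both.
  set g : Option (Fin N) → (ℕ × ℕ) ⊕ ℕ := fun o => o.elim (Sum.inr n) fun j => Sum.inl (n, j)
  have hg : Function.Injective g := by
    rintro (_ | i) (_ | j) h <;> simp [g] at h ⊢
    exact Fin.ext h
  have hmeas : ∀ i, AEMeasurable (Sum.elim (fun p : ℕ × ℕ => ξ p.1 p.2) ε (g i)) P := by
    rintro (_ | j)
    · exact (hinput.measurable_immigration n).aemeasurable
    · exact (hinput.measurable_offspring n j).aemeasurable
  have h := (hinput.indep.precomp hg).integral_fun_prod_comp (f := fun _ k => s ^ k) hmeas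
    fun i => (measurable_of_countable _).aestronglyMeasurable
  simp only [Fintype.prod_option, g, Option.elim_none, Option.elim_some, Sum.elim_inr,
    Sum.elim_inl] at h
  have hid : ∀ j, ∫ ω, s ^ ξ n j ω ∂P = ∫ ω, s ^ ξ n 0 ω ∂P := fun j =>
    ((hinput.identDistrib n j).comp (measurable_of_countable fun k : ℕ => s ^ k)).integral_eq
  simp only [hid, Finset.prod_const, Finset.card_univ, Fintype.card_fin] at h
  rw [mul_comm, ← h]
  refine integral_congr_ae (ae_of_all _ fun ω => ?_)
  simp only
  rw [pow_add, ← Finset.prod_pow_eq_pow_sum, Finset.prod_range, mul_comm]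

theorem IsBranchingInput.integral_pow_process_succ [IsProbabilityMeasure P]
    (hinput : IsBranchingInput P ξ ε) (n : ℕ) {s : ℝ}
    (hs : s ∈ Set.Icc (0 : ℝ) 1) :
    ∫ ω, s ^ processWithImmigration ξ ε (n + 1) ω ∂P =
      (∫ ω, s ^ ε n ω ∂P) *
        ∫ ω, (∫ ω, s ^ ξ n 0 ω ∂P) ^ processWithImmigration ξ ε n ω ∂P := by
  have hY := measurable_process hinput.measurable_offspring hinput.measurable_immigration n
  have hW : Measurable fun ω => ((fun j => ξ n j ω : ℕ → ℕ), ε n ω) :=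
    (measurable_pi_lambda _ fun j => hinput.measurable_offspring n j).prodMk
      (hinput.measurable_immigration n)
  have := Measure.isProbabilityMeasure_map (μ := P) hY.aemeasurable
  have := Measure.isProbabilityMeasure_map (μ := P) hW.aemeasurable
  have hF : Measurable fun q : ℕ × ((ℕ → ℕ) × ℕ) =>
      (∑ j ∈ Finset.range q.1, q.2.1 j) + q.2.2 :=
    measurable_from_prod_countable_right fun N => by
      have h : Measurable fun w : (ℕ → ℕ) × ℕ => ∑ j ∈ Finset.range N, w.1 j :=
        Finset.measurable_sum _ fun j _ => (measurable_pi_apply j).comp measurable_fst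
      exact h.add measurable_snd
  have hpow : Measurable fun k : ℕ => s ^ k := measurable_of_countable _
  -- The joint law of population and fresh inputs is a product, so Fubini's theorem replaces
  -- conditioning on the population size.
  have h1 := (indepFun_iff_map_prod_eq_prod_map_map hY.aemeasurable hW.aemeasurable).1
    (hinput.indepFun_process n)
  calc ∫ ω, s ^ processWithImmigration ξ ε (n + 1) ω ∂P
      = ∫ q : ℕ × ((ℕ → ℕ) × ℕ), s ^ ((∑ j ∈ Finset.range q.1, q.2.1 j) + q.2.2)
          ∂(P.map fun ω => (processWithImmigration ξ ε n ω, ((fun j => ξ n j ω : ℕ → ℕ), ε n ω))) :=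
        (integral_map (hY.prodMk hW).aemeasurable (hpow.comp hF).aestronglyMeasurable).symm
    _ = ∫ y, ∫ w, s ^ ((∑ j ∈ Finset.range y, w.1 j) + w.2)
          ∂(P.map fun ω => ((fun j => ξ n j ω : ℕ → ℕ), ε n ω))
          ∂(P.map (processWithImmigration ξ ε n)) := by
        rw [h1, integral_prod _ (integrable_pow hF hs)]
    _ = ∫ y, (∫ ω, s ^ ξ n 0 ω ∂P) ^ y * ∫ ω, s ^ ε n ω ∂P
          ∂(P.map (processWithImmigration ξ ε n)) := by
        refine integral_congr_ae (ae_of_all _ fun y => ?_)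
        simp only
        rw [← hinput.integral_pow_generation n y s,
          integral_map hW.aemeasurable]
        exact (hpow.comp (hF.comp measurable_prodMk_left)).aestronglyMeasurable
    _ = _ := by
        rw [integral_mul_const, mul_comm, integral_map hY.aemeasurable
          (measurable_of_countable _).aestronglyMeasurable]

/-- The input in which only the immigrants of one generation are kept. -/
theorem IsBranchingInput.single (hinput : IsBranchingInput P ξ ε) (i : ℕ) :
    IsBranchingInput P ξ (fun j => if j = i then ε j else 0) where
  measurable_offspring := hinput.measurable_offspring
  measurable_immigration j := by
    split_ifs
    · exact hinput.measurable_immigration j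
    · exact measurable_const
  identDistrib := hinput.identDistrib
  indep := by
    have h := hinput.indep.comp
      (fun o => Sum.elim (fun _ => id) (fun j => if j = i then id else 0) o)
      (fun _ => measurable_of_countable _)
    convert! h using 1
    funext o
    rcases o with p | j
    · rfl
    · simp only [Sum.elim_inr]
      split_ifs <;> rfl

end Generations

/-! ### Complementary generating functions, the product formula and the compound-Poisson exponent.
-/

/-- The complement to `1` of the generating function, as a function of the distance to `1`. -/
noncomputable def compGF {Ω : Type*} [MeasurableSpace Ω] (P : Measure Ω) (X : Ω → ℕ) (x : ℝ) : ℝ :=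
  1 - ∫ ω, (1 - x) ^ X ω ∂P

section CompGF

variable {Ω : Type*} [MeasurableSpace Ω] {P : Measure Ω} [IsProbabilityMeasure P]

theorem one_sub_mem {x : ℝ} (hx : x ∈ Set.Icc (0 : ℝ) 1) : 1 - x ∈ Set.Icc (0 : ℝ) 1 :=
  ⟨sub_nonneg.2 hx.2, sub_le_self 1 hx.1⟩

theorem compGF_mem {X : Ω → ℕ} (hX : Measurable X) {x : ℝ} (hx : x ∈ Set.Icc (0 : ℝ) 1) :
    compGF P X x ∈ Set.Icc (0 : ℝ) 1 :=
  one_sub_mem (integral_pow_mem hX (one_sub_mem hx))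

theorem compGF_zero_fun (x : ℝ) : compGF P (0 : Ω → ℕ) x = 0 := by simp [compGF]

/-- Proved by dominated convergence without any moment, because the immigration moments of early
generations may be infinite. -/
theorem compGF_tendsto_zero {X : Ω → ℕ} (hX : Measurable X) :
    Tendsto (compGF P X) (𝓝[Set.Icc 0 1] 0) (𝓝 0) := by
  have h : Tendsto (fun x : ℝ => ∫ ω, (1 - x) ^ X ω ∂P) (𝓝[Set.Icc 0 1] 0)
      (𝓝 (∫ _, (1 : ℝ) ∂P)) := by
    refine tendsto_integral_filter_of_dominated_convergence (fun _ => 1) ?_ ?_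
      (integrable_const _) (ae_of_all _ fun ω => ?_)
    · exact eventually_mem_nhdsWithin.mono fun x hx =>
        (integrable_pow hX (one_sub_mem hx)).aestronglyMeasurable
    · refine eventually_mem_nhdsWithin.mono fun x hx => ae_of_all _ fun ω => ?_
      have := one_sub_mem hx
      rw [norm_pow, Real.norm_of_nonneg this.1]
      exact pow_le_one₀ this.1 this.2
    · have : Continuous fun x : ℝ => (1 - x) ^ X ω := by fun_prop
      simpa using (this.tendsto 0).mono_left nhdsWithin_le_nhds
  simpa [funext fun x => compGF.eq_1 P X x] using h.const_sub 1

/-- The expansion of a generating function by factorial moments, with its remainder. -/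
theorem abs_compGF_add_sum_le {X : Ω → ℕ} (hX : Measurable X) {K : ℕ} (hK : 1 ≤ K)
    (hfin : ∀ k, 1 ≤ k → k ≤ K → factorialMoment P X k ≠ ∞) {x : ℝ}
    (hx : x ∈ Set.Icc (0 : ℝ) 1) :
    |compGF P X x + ∑ k ∈ Finset.Icc 1 (K - 1),
        (factorialMoment P X k).toReal / k.factorial * (-x) ^ k| ≤
      (factorialMoment P X K).toReal / K.factorial * x ^ K := by
  have hmeas : ∀ k, Measurable fun ω => (((X ω).descFactorial k : ℕ) : ℝ) := fun k =>
    (measurable_of_countable fun m : ℕ => ((m.descFactorial k : ℕ) : ℝ)).comp hX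
  have hlint : ∀ k, ∫⁻ ω, ENNReal.ofReal ((X ω).descFactorial k : ℝ) ∂P = factorialMoment P X k :=
    fun k => by simp [factorialMoment]
  have hintd : ∀ k, k ≤ K → Integrable (fun ω => ((X ω).descFactorial k : ℝ)) P := fun k hk => by
    rcases Nat.eq_zero_or_pos k with rfl | hk0
    · simp
    · refine (lintegral_ofReal_ne_top_iff_integrable (hmeas k).aestronglyMeasurable
        (ae_of_all _ fun ω => Nat.cast_nonneg _)).1 ?_
      rw [hlint]
      exact hfin k hk0 hk
  have hval : ∀ k, ∫ ω, ((X ω).descFactorial k : ℝ) ∂P = (factorialMoment P X k).toReal :=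
    fun k => by
      rw [integral_eq_lintegral_of_nonneg_ae (ae_of_all _ fun ω => Nat.cast_nonneg _)
        (hmeas k).aestronglyMeasurable, hlint]
  have hchoose : ∀ m k : ℕ, (m.choose k : ℝ) = (m.descFactorial k : ℝ) / k.factorial := fun m k => by
    rw [eq_div_iff (by positivity), Nat.descFactorial_eq_factorial_mul_choose]
    push_cast; ring
  have hint : ∀ k, k ≤ K → Integrable (fun ω => ((X ω).choose k : ℝ)) P := fun k hk => by
    simp_rw [hchoose]; exact (hintd k hk).div_const _
  have hcval : ∀ k, ∫ ω, ((X ω).choose k : ℝ) ∂P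
      = (factorialMoment P X k).toReal / k.factorial := fun k => by
    simp_rw [hchoose]; rw [integral_div, hval]
  have hpow := integrable_pow (P := P) hX (one_sub_mem hx)
  have hsumint : Integrable (fun ω => ∑ i ∈ Finset.range K, ((X ω).choose i : ℝ) * (-x) ^ i) P :=
    integrable_finsetSum _ fun i hi => (hint i (Finset.mem_range.1 hi).le).mul_const _
  have hsumval : ∫ ω, ∑ i ∈ Finset.range K, ((X ω).choose i : ℝ) * (-x) ^ i ∂P
      = 1 + ∑ k ∈ Finset.Icc 1 (K - 1),
        (factorialMoment P X k).toReal / k.factorial * (-x) ^ k := by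
    rw [integral_finsetSum _ fun i hi => (hint i (Finset.mem_range.1 hi).le).mul_const _]
    simp_rw [integral_mul_const, hcval]
    have : Finset.range K = insert 0 (Finset.Icc 1 (K - 1)) := by
      ext i; simp only [Finset.mem_range, Finset.mem_insert, Finset.mem_Icc]; omega
    rw [this, Finset.sum_insert (by simp)]
    simp [factorialMoment]
  have h1 : compGF P X x + ∑ k ∈ Finset.Icc 1 (K - 1),
        (factorialMoment P X k).toReal / k.factorial * (-x) ^ k
      = -∫ ω, ((1 - x) ^ X ω - ∑ i ∈ Finset.range K, ((X ω).choose i : ℝ) * (-x) ^ i) ∂P := by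
    rw [integral_sub hpow hsumint, hsumval, compGF]; ring
  rw [h1, abs_neg, ← hcval, ← integral_mul_const]
  refine (abs_integral_le_integral_abs).trans (integral_mono (hpow.sub hsumint).abs
    ((hint K le_rfl).mul_const _) fun ω => bonferroni_abs_le hx _ _)

variable {ξ : ℕ → ℕ → Ω → ℕ} {ε : ℕ → Ω → ℕ}

theorem IsBranchingInput.integral_pow_process (hinput : IsBranchingInput P ξ ε) (n : ℕ) {x : ℝ}
    (hx : x ∈ Set.Icc (0 : ℝ) 1) :
    ∫ ω, (1 - x) ^ processWithImmigration ξ ε n ω ∂P =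
      ∏ j ∈ Finset.range n,
        (1 - compGF P (ε j) (chain (fun n => compGF P (ξ n 0)) (j + 1) n x)) := by
  induction n generalizing x with
  | zero => simp [processWithImmigration]
  | succ n ih =>
    have hU := compGF_mem (P := P) (hinput.measurable_offspring n 0) hx
    rw [hinput.integral_pow_process_succ n (one_sub_mem hx), Finset.prod_range_succ,
      chain_of_le le_rfl, mul_comm]
    congr 1
    · have := ih hU
      rw [compGF, sub_sub_cancel] at this
      rw [this]
      refine Finset.prod_congr rfl fun j hj => ?_
      rw [chain_succ (by have := Finset.mem_range.1 hj; omega)]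
      rfl
    · rw [compGF, sub_sub_cancel]

/-- This gives each summand of the Riemann sum a probabilistic meaning: it is one minus the
generating function of the descendants at time `n` of a single generation's immigrants. -/
theorem IsBranchingInput.integral_pow_process_single (hinput : IsBranchingInput P ξ ε) {i n : ℕ}
    (hi : i < n) {x : ℝ} (hx : x ∈ Set.Icc (0 : ℝ) 1) :
    ∫ ω, (1 - x) ^ processWithImmigration ξ (fun j => if j = i then ε j else 0) n ω ∂P =
      1 - compGF P (ε i) (chain (fun n => compGF P (ξ n 0)) (i + 1) n x) := by
  rw [(hinput.single i).integral_pow_process n hx, Finset.prod_eq_single i]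
  · rw [if_pos rfl]
  · intro j _ hj
    rw [if_neg hj, compGF_zero_fun, sub_zero]
  · intro h; exact absurd (Finset.mem_range.2 hi) h

/-- If the sums of the complements of the generating functions converge, then the limit is the
exponent of a compound-Poisson law. -/
theorem IsBranchingInput.exists_compoundPoisson (hinput : IsBranchingInput P ξ ε) {H : ℝ → ℝ}
    (hH0 : H 0 = 0) (hHc : ContinuousWithinAt H (Set.Ioi 0) 0)
    (h : ∀ x ∈ Set.Icc (0 : ℝ) 1, Tendsto (fun n => ∑ j ∈ Finset.range n,
      compGF P (ε j) (chain (fun n => compGF P (ξ n 0)) (j + 1) n x)) atTop (𝓝 (H x))) :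
    ∃ (θ : ℝ≥0) (Q : Measure ℕ) (_ : IsProbabilityMeasure Q), ∀ s ∈ Set.Icc (0 : ℝ) 1,
      ∫ y, s ^ y ∂(compoundPoisson θ Q) = Real.exp (-H (1 - s)) := by
  set Y : ℕ → ℕ → Ω → ℕ := fun i n =>
    processWithImmigration ξ (fun j => if j = i then ε j else 0) n with hYdef
  have hY : ∀ i n, Measurable (Y i n) := fun i n =>
    measurable_process (hinput.single i).measurable_offspring
      (hinput.single i).measurable_immigration n
  have h1mem : (1 : ℝ) ∈ Set.Icc (0 : ℝ) 1 := by simp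
  have h0mem : (0 : ℝ) ∈ Set.Icc (0 : ℝ) 1 := by simp
  -- Coefficient `k` adds up the probabilities that the immigrants of one generation have `k`
  -- descendants. The mass at `0` is dropped: it grows with the number of generations, while the
  -- other masses are bounded by the convergent sums at `x = 1`.
  set b : ℕ → ℕ → ℝ := fun n k =>
    if k = 0 then 0 else ∑ i ∈ Finset.range n, P.real (Y i n ⁻¹' {k}) with hb
  have hb0 : ∀ n k, 0 ≤ b n k := fun n k => by
    rw [hb]; simp only
    split_ifs
    · exact le_rfl
    · exact Finset.sum_nonneg fun _ _ => measureReal_nonneg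
  have hsum : ∀ n, ∀ x ∈ Set.Icc (0 : ℝ) 1, HasSum (fun k => b n k * (1 - x) ^ k)
      (∑ j ∈ Finset.range n, compGF P (ε j) (chain (fun n => compGF P (ξ n 0)) (j + 1) n 1) -
        ∑ j ∈ Finset.range n,
          compGF P (ε j) (chain (fun n => compGF P (ξ n 0)) (j + 1) n x)) := fun n x hx => by
    rw [← Finset.sum_sub_distrib]
    have hall := hasSum_sum (s := Finset.range n) fun i _ =>
      ((hasSum_integral_pow (P := P) (hY i n) (one_sub_mem hx)).sub
        (hasSum_integral_pow (P := P) (hY i n) h0mem))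
    convert! hall using 1
    · funext k
      rcases Nat.eq_zero_or_pos k with rfl | hk
      · simp [hb]
      · simp [hb, hk.ne', Finset.sum_mul]
    · refine Finset.sum_congr rfl fun i hi => ?_
      have e1 := hinput.integral_pow_process_single (Finset.mem_range.1 hi) hx
      have e2 := hinput.integral_pow_process_single (Finset.mem_range.1 hi) h1mem
      rw [sub_self] at e2
      rw [hYdef]
      simp only
      rw [e1, e2]
      ring
  obtain ⟨C, hC⟩ : ∃ C, ∀ n, ∑ j ∈ Finset.range n,
      compGF P (ε j) (chain (fun n => compGF P (ξ n 0)) (j + 1) n 1) ≤ C := by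
    obtain ⟨C, hC⟩ := (h 1 h1mem).bddAbove_range
    exact ⟨C, fun n => hC ⟨n, rfl⟩⟩
  have hchain0 : ∀ j n, chain (fun n => compGF P (ξ n 0)) j n 0 = 0 := fun j n => by
    induction n with
    | zero => rfl
    | succ n ih => rw [chain]; split_ifs <;> simp [compGF, ih]
  have hbC : ∀ n k, b n k ∈ Set.Icc 0 C := fun n k => by
    refine ⟨hb0 n k, le_trans ?_ (hC n)⟩
    have h2 := hsum n 0 h0mem
    simp only [sub_zero, one_pow, mul_one, hchain0] at h2
    have h3 : ∑ j ∈ Finset.range n, compGF P (ε j) 0 = 0 :=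
      Finset.sum_eq_zero fun j _ => by simp [compGF]
    rw [h3, sub_zero] at h2
    exact le_hasSum h2 k fun k _ => hb0 n k
  have hcont : ContinuousWithinAt (fun s => H 1 - H (1 - s)) (Set.Iio 1) 1 := by
    have h4 : Tendsto (fun s : ℝ => 1 - s) (𝓝[<] 1) (𝓝[>] 0) := by
      rw [tendsto_nhdsWithin_iff]
      refine ⟨?_, eventually_mem_nhdsWithin.mono fun s hs => Set.mem_Ioi.2 (sub_pos.2 (Set.mem_Iio.1 hs))⟩
      have : Continuous fun s : ℝ => 1 - s := by fun_prop
      simpa using (this.tendsto 1).mono_left nhdsWithin_le_nhds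
    have h5 : Tendsto (fun s : ℝ => H (1 - s)) (𝓝[<] 1) (𝓝 (H 0)) := hHc.tendsto.comp h4
    simpa [ContinuousWithinAt] using h5.const_sub (H 1)
  obtain ⟨θ, Q, hQ, hval⟩ := BranchingImmigration.exists_compoundPoisson hbC hcont
    fun s hs => by
      have hs' := one_sub_mem ⟨hs.1, hs.2.le⟩
      refine ((h 1 h1mem).sub (h (1 - s) hs')).congr fun n => ?_
      have := (hsum n (1 - s) hs').tsum_eq
      rw [sub_sub_cancel] at this
      exact this.symm
  refine ⟨θ, Q, hQ, fun s hs => ?_⟩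
  rw [hval s hs]
  simp [hH0]

end CompGF

/-! ### Real-valued moment ratios and derivatives of the limiting exponents. -/

/-- A finite limit forces the numerators to be finite eventually, because the denominators are
finite. -/
theorem tendsto_toReal_ratio {M m : ℕ → ℝ≥0∞} (hm : ∀ n, m n < 1) {c : ℕ} {L : ℝ≥0}
    (h : Tendsto (fun n => M n / (c * (1 - m n))) atTop (𝓝 (L : ℝ≥0∞))) :
    (∀ᶠ n in atTop, M n ≠ ∞) ∧
      Tendsto (fun n => (M n).toReal / c / (1 - (m n).toReal)) atTop (𝓝 (L : ℝ)) := by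
  constructor
  · filter_upwards [h.eventually_lt_const ENNReal.coe_lt_top] with n hn hM
    rw [hM, ENNReal.top_div_of_ne_top] at hn
    · exact lt_irrefl _ hn
    · exact ENNReal.mul_ne_top (ENNReal.natCast_ne_top c)
        (ne_top_of_le_ne_top ENNReal.one_ne_top tsub_le_self)
  · have h1 := (ENNReal.tendsto_toReal ENNReal.coe_ne_top).comp h
    refine h1.congr fun n => ?_
    simp only [Function.comp_apply, ENNReal.toReal_div, ENNReal.toReal_mul, ENNReal.toReal_natCast,
      ENNReal.toReal_sub_of_le (hm n).le ENNReal.one_ne_top, ENNReal.toReal_one]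
    rw [div_div]

/-- The polynomial cancels the first `m` Taylor terms of the logarithm at `0`, so the derivative is
the remainder of a geometric series. -/
theorem hasDerivAt_log_add_sum {r : ℝ} (hr : 0 < r) (m : ℕ) {x : ℝ} (hx : 0 ≤ x) :
    HasDerivAt (fun x : ℝ => Real.log (1 + r * x) +
        ∑ i ∈ Finset.Icc 1 m, (-1 : ℝ) ^ i * (r ^ i / i) * x ^ i)
      (r * (-(r * x)) ^ m / (1 + r * x)) x := by
  have hpos : 0 < 1 + r * x := by positivity
  induction m with
  | zero =>
    have h1 : HasDerivAt (fun x : ℝ => 1 + r * x) r x := by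
      simpa using ((hasDerivAt_id x).const_mul r).const_add 1
    simpa using h1.log hpos.ne'
  | succ m ih =>
    have h1 := ih.add ((hasDerivAt_pow (m + 1) x).const_mul
      ((-1 : ℝ) ^ (m + 1) * (r ^ (m + 1) / ((m + 1 : ℕ) : ℝ))))
    convert! h1 using 1
    · funext y
      simp only [Pi.add_apply]
      rw [Finset.sum_Icc_succ_top (by omega), add_assoc]
    · have hm : ((m + 1 : ℕ) : ℝ) ≠ 0 := by positivity
      rw [Nat.add_sub_cancel, div_add' _ _ _ hpos.ne']
      congr 1
      have e : ((-1 : ℝ) ^ (m + 1) * (r ^ (m + 1) / ((m + 1 : ℕ) : ℝ))) *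
          (((m + 1 : ℕ) : ℝ) * x ^ m) = (-1) ^ (m + 1) * r ^ (m + 1) * x ^ m := by
        field_simp
      rw [e, neg_pow, neg_pow (r * x) m, mul_pow, mul_pow]
      ring

/-- The exponent of `limitGF`, up to sign, as a function of `x = 1 - s`. -/
theorem hasDerivAt_limitGF_exponent {ν : ℝ} (hν : 0 < ν) (lam : ℕ → ℝ) (K : ℕ) {x : ℝ}
    (hx : 0 ≤ x) :
    HasDerivAt (fun x : ℝ => ∑ k ∈ Finset.Icc 1 (K - 1), 2 ^ k * lam k / ν ^ k *
        (Real.log (1 + ν / 2 * x) +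
          ∑ i ∈ Finset.Icc 1 (k - 1), (-1) ^ i * (ν ^ i / (i * 2 ^ i)) * x ^ i))
      ((∑ k ∈ Finset.Icc 1 (K - 1), lam k * (-x) ^ (k - 1)) / (1 + ν / 2 * x)) x := by
  rw [Finset.sum_div]
  refine HasDerivAt.fun_sum fun k hk => ?_
  have h := (hasDerivAt_log_add_sum (half_pos hν) (k - 1) hx).const_mul (2 ^ k * lam k / ν ^ k)
  have e1 : ∀ i : ℕ, (ν / 2) ^ i / i = ν ^ i / (i * 2 ^ i) := fun i => by
    rw [div_pow, div_div, mul_comm]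
  simp only [e1] at h
  convert! h using 1
  obtain ⟨m, rfl⟩ : ∃ m, k = m + 1 := ⟨k - 1, by have := (Finset.mem_Icc.1 hk).1; omega⟩
  rw [Nat.add_sub_cancel, ← mul_div_assoc]
  congr 1
  have hν' := hν.ne'
  rw [neg_pow, neg_pow (ν / 2 * x), mul_pow, div_pow]
  field_simp
  ring

theorem hasDerivAt_limitGFZero_exponent (lam : ℕ → ℝ) (K : ℕ) (x : ℝ) :
    HasDerivAt (fun x : ℝ => -∑ k ∈ Finset.Icc 1 (K - 1), (-1) ^ k * lam k * x ^ k / k)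
      (∑ k ∈ Finset.Icc 1 (K - 1), lam k * (-x) ^ (k - 1)) x := by
  rw [← neg_neg (∑ k ∈ Finset.Icc 1 (K - 1), lam k * (-x) ^ (k - 1)), ← Finset.sum_neg_distrib]
  refine HasDerivAt.neg (HasDerivAt.fun_sum fun k hk => ?_)
  have h := ((hasDerivAt_pow k x).const_mul ((-1) ^ k * lam k)).div_const (k : ℝ)
  convert! h using 1
  obtain ⟨m, rfl⟩ : ∃ m, k = m + 1 := ⟨k - 1, by have := (Finset.mem_Icc.1 hk).1; omega⟩
  have hm : ((m + 1 : ℕ) : ℝ) ≠ 0 := by positivity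
  rw [Nat.add_sub_cancel, neg_pow, eq_div_iff hm]
  ring

theorem factorialMoment_one {Ω : Type*} [MeasurableSpace Ω] (P : Measure Ω) (X : Ω → ℕ) :
    factorialMoment P X 1 = ∫⁻ ω, (X ω : ℝ≥0∞) ∂P := by
  simp [factorialMoment]

/-! ### Uniform expansions at `0` from the moment conditions, and the limit theorem. -/

section Limit

variable {Ω : Type*} [MeasurableSpace Ω] {P : Measure Ω} [IsProbabilityMeasure P]

theorem abs_compGF_sub_mean_le {X : Ω → ℕ} (hX : Measurable X)
    (h1 : factorialMoment P X 1 ≠ ∞) (h2 : factorialMoment P X 2 ≠ ∞) {x : ℝ}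
    (hx : x ∈ Set.Icc (0 : ℝ) 1) :
    |compGF P X x - (factorialMoment P X 1).toReal * x| ≤
      (factorialMoment P X 2).toReal / 2 * x ^ 2 := by
  have h := abs_compGF_add_sum_le (K := 2) hX (by omega) (fun k hk hk' => by
    interval_cases k <;> assumption) hx
  have e : Finset.Icc 1 (2 - 1) = {1} := rfl
  rw [e, Finset.sum_singleton] at h
  simpa [Nat.factorial, ← sub_eq_add_neg] using h

theorem abs_compGF_sub_second_order_le {X : Ω → ℕ} (hX : Measurable X)
    (h1 : factorialMoment P X 1 ≠ ∞) (h2 : factorialMoment P X 2 ≠ ∞)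
    (h3 : factorialMoment P X 3 ≠ ∞) {x : ℝ} (hx : x ∈ Set.Icc (0 : ℝ) 1) :
    |compGF P X x - (factorialMoment P X 1).toReal * x
        + (factorialMoment P X 2).toReal / 2 * x ^ 2| ≤
      (factorialMoment P X 3).toReal / 6 * x ^ 3 := by
  have h := abs_compGF_add_sum_le (K := 3) hX (by omega) (fun k hk hk' => by
    interval_cases k <;> assumption) hx
  have e : Finset.Icc 1 (3 - 1) = {1, 2} := rfl
  rw [e, Finset.sum_pair (by norm_num)] at h
  simpa [Nat.factorial, sub_eq_add_neg, add_assoc] using h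

theorem compGF_le_mean {X : Ω → ℕ} (hX : Measurable X)
    (h1 : factorialMoment P X 1 ≠ ∞) {x : ℝ} (hx : x ∈ Set.Icc (0 : ℝ) 1) :
    compGF P X x ≤ (factorialMoment P X 1).toReal * x := by
  have h := abs_compGF_add_sum_le (K := 1) hX le_rfl (fun k hk hk' => by
    interval_cases k; assumption) hx
  simp only [Nat.sub_self, Nat.factorial, Finset.Icc_eq_empty (show ¬ (1 : ℕ) ≤ 0 by omega),
    Finset.sum_empty, add_zero, mul_one, Nat.cast_one, div_one, pow_one] at h
  exact (le_abs_self _).trans h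

variable {ξ : ℕ → ℕ → Ω → ℕ} {ε : ℕ → Ω → ℕ}

/-- Expansion of the immigration generating functions relative to the offspring defects. -/
theorem immigration_expansion (hε : ∀ n, Measurable (ε n)) {a : ℕ → ℝ} (ha : ∀ n, 0 < a n)
    {K : ℕ} (hK : 1 ≤ K) {lam : ℕ → ℝ}
    (himm : ∀ k, 1 ≤ k → k ≤ K → (∀ᶠ n in atTop, factorialMoment P (ε n) k ≠ ∞) ∧
      Tendsto (fun n => (factorialMoment P (ε n) k).toReal / k.factorial / a n) atTop
        (𝓝 (lam k)))
    (hlamK : lam K = 0) {δ : ℝ} (hδ : 0 < δ) :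
    ∀ᶠ n in atTop, ∀ x ∈ Set.Icc (0 : ℝ) 1,
      |compGF P (ε n) x - a n * (x * ∑ k ∈ Finset.Icc 1 (K - 1), lam k * (-x) ^ (k - 1))| ≤
        δ * (a n * x) := by
  set M : ℕ → ℕ → ℝ := fun k n => (factorialMoment P (ε n) k).toReal / k.factorial with hM
  -- Since `x ^ k ≤ x` on `[0, 1]` for `k ≥ 1`, this single null sequence controls all coefficient
  -- errors uniformly in `x`. Its term `k = K` controls the Bonferroni remainder.
  have hlim : Tendsto (fun n => ∑ k ∈ Finset.Icc 1 K, |M k n / a n - lam k|) atTop (𝓝 0) := by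
    rw [← Finset.sum_const_zero (s := Finset.Icc 1 K)]
    refine tendsto_finsetSum _ fun k hk => ?_
    rw [Finset.mem_Icc] at hk
    simpa using ((himm k hk.1 hk.2).2.sub_const (lam k)).abs
  have hfin : ∀ᶠ n in atTop, ∀ k ∈ Finset.Icc 1 K, factorialMoment P (ε n) k ≠ ∞ :=
    (Filter.eventually_all_finset _).2 fun k hk =>
      (himm k (Finset.mem_Icc.1 hk).1 (Finset.mem_Icc.1 hk).2).1
  filter_upwards [hfin, hlim.eventually_lt_const hδ] with n hn hnδ x hx
  have han := ha n
  have h1 := abs_compGF_add_sum_le (hε n) hK (fun k hk hk' => hn k (Finset.mem_Icc.2 ⟨hk, hk'⟩)) hx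
  have hxk : ∀ k, 1 ≤ k → x ^ k ≤ x := fun k hk =>
    pow_le_of_le_one hx.1 hx.2 (by omega)
  have hterm : ∀ k, 1 ≤ k → |(M k n - a n * lam k) * (-x) ^ k| ≤
      |M k n / a n - lam k| * (a n * x) := fun k hk => by
    have e : M k n - a n * lam k = (M k n / a n - lam k) * a n := by field_simp
    rw [e, abs_mul, abs_mul, abs_pow, abs_neg, abs_of_pos han, abs_of_nonneg hx.1, mul_assoc]
    exact mul_le_mul_of_nonneg_left (mul_le_mul_of_nonneg_left (hxk k hk) han.le) (abs_nonneg _)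
  have e2 : x * ∑ k ∈ Finset.Icc 1 (K - 1), lam k * (-x) ^ (k - 1)
      = -∑ k ∈ Finset.Icc 1 (K - 1), lam k * (-x) ^ k := by
    rw [Finset.mul_sum, ← Finset.sum_neg_distrib]
    refine Finset.sum_congr rfl fun k hk => ?_
    obtain ⟨m, rfl⟩ : ∃ m, k = m + 1 := ⟨k - 1, by have := (Finset.mem_Icc.1 hk).1; omega⟩
    rw [Nat.add_sub_cancel, pow_succ]; ring
  have e3 : compGF P (ε n) x - a n * (x * ∑ k ∈ Finset.Icc 1 (K - 1), lam k * (-x) ^ (k - 1))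
      = (compGF P (ε n) x + ∑ k ∈ Finset.Icc 1 (K - 1), M k n * (-x) ^ k)
        - ∑ k ∈ Finset.Icc 1 (K - 1), (M k n - a n * lam k) * (-x) ^ k := by
    rw [e2]
    simp only [sub_mul, Finset.sum_sub_distrib, mul_assoc, ← Finset.mul_sum]
    ring
  -- Here `lam K = 0` enters: it makes the remainder of order `K` negligible against `a n * x`.
  have hlast : M K n * x ^ K ≤ |M K n / a n - lam K| * (a n * x) := by
    have h := hterm K hK
    rw [hlamK, mul_zero, sub_zero, abs_mul, abs_pow, abs_neg, abs_of_nonneg hx.1] at h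
    rw [hlamK]
    exact (mul_le_mul_of_nonneg_right (le_abs_self _) (pow_nonneg hx.1 _)).trans h
  rw [e3]
  calc _ ≤ |compGF P (ε n) x + ∑ k ∈ Finset.Icc 1 (K - 1), M k n * (-x) ^ k|
        + |∑ k ∈ Finset.Icc 1 (K - 1), (M k n - a n * lam k) * (-x) ^ k| := abs_sub _ _
    _ ≤ |M K n / a n - lam K| * (a n * x)
        + ∑ k ∈ Finset.Icc 1 (K - 1), |M k n / a n - lam k| * (a n * x) := by
        refine add_le_add (h1.trans hlast) ((Finset.abs_sum_le_sum_abs _ _).trans ?_)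
        exact Finset.sum_le_sum fun k hk => hterm k (Finset.mem_Icc.1 hk).1
    _ = (∑ k ∈ Finset.Icc 1 K, |M k n / a n - lam k|) * (a n * x) := by
        obtain ⟨m, rfl⟩ : ∃ m, K = m + 1 := ⟨K - 1, by omega⟩
        rw [Nat.add_sub_cancel, Finset.sum_Icc_succ_top (by omega), add_mul, Finset.sum_mul,
          add_comm]
    _ ≤ δ * (a n * x) := mul_le_mul_of_nonneg_right hnδ.le (mul_nonneg han.le hx.1)

/-- Expansion of the offspring generating functions relative to their defects. -/
theorem offspring_expansion (hξ : ∀ n j, Measurable (ξ n j))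
    (hmean_lt : ∀ n, offspringMean P ξ n < 1) {a : ℕ → ℝ}
    (ha : ∀ n, a n = 1 - (offspringMean P ξ n).toReal) (ha0 : ∀ n, 0 < a n) {ν : ℝ} (hν : 0 ≤ ν)
    (hsecond : (∀ᶠ n in atTop, factorialMoment P (ξ n 0) 2 ≠ ∞) ∧
      Tendsto (fun n => (factorialMoment P (ξ n 0) 2).toReal / a n) atTop (𝓝 ν))
    (hthird : 0 < ν → (∀ᶠ n in atTop, factorialMoment P (ξ n 0) 3 ≠ ∞) ∧
      Tendsto (fun n => (factorialMoment P (ξ n 0) 3).toReal / a n) atTop (𝓝 0))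
    {δ : ℝ} (hδ : 0 < δ) :
    ∀ᶠ n in atTop, ∀ x ∈ Set.Icc (0 : ℝ) 1,
      |x - compGF P (ξ n 0) x - a n * (x + ν / 2 * x ^ 2)| ≤ δ * (a n * x) := by
  have hm1 : ∀ n, factorialMoment P (ξ n 0) 1 = offspringMean P ξ n := fun n =>
    factorialMoment_one _ _
  have hfin1 : ∀ n, factorialMoment P (ξ n 0) 1 ≠ ∞ := fun n => by
    rw [hm1]; exact ((hmean_lt n).trans ENNReal.one_lt_top).ne
  have hval1 : ∀ n, (factorialMoment P (ξ n 0) 1).toReal = 1 - a n := fun n => by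
    rw [hm1, ha]; ring
  -- For `ν = 0` the second moment is itself negligible, so the first-order expansion suffices. For
  -- `ν > 0` the second-order term stays and the third moment controls the remainder.
  rcases hν.eq_or_lt with rfl | hpos
  · filter_upwards [hsecond.1, hsecond.2.eventually_lt_const hδ] with n hn hnδ x hx
    have h := abs_compGF_sub_mean_le (hξ n 0) (hfin1 n) hn hx
    rw [hval1] at h
    rw [div_lt_iff₀ (ha0 n)] at hnδ
    have e : x - compGF P (ξ n 0) x - a n * (x + 0 / 2 * x ^ 2)
        = -(compGF P (ξ n 0) x - (1 - a n) * x) := by ring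
    rw [e, abs_neg]
    refine h.trans ?_
    have hx2 : x ^ 2 ≤ x := pow_le_of_le_one hx.1 hx.2 two_ne_zero
    have hM : 0 ≤ (factorialMoment P (ξ n 0) 2).toReal := ENNReal.toReal_nonneg
    calc _ ≤ (factorialMoment P (ξ n 0) 2).toReal * x := by
          refine mul_le_mul (by linarith) hx2 (sq_nonneg _) hM
      _ ≤ δ * a n * x := mul_le_mul_of_nonneg_right hnδ.le hx.1
      _ = _ := by ring
  · obtain ⟨h3fin, h3⟩ := hthird hpos
    have hlim : Tendsto (fun n => |(factorialMoment P (ξ n 0) 2).toReal / a n - ν|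
        + (factorialMoment P (ξ n 0) 3).toReal / a n) atTop (𝓝 0) := by
      simpa using (hsecond.2.sub_const ν).abs.add h3
    filter_upwards [hsecond.1, h3fin, hlim.eventually_lt_const hδ] with n hn2 hn3 hnδ x hx
    have h := abs_compGF_sub_second_order_le (hξ n 0) (hfin1 n) hn2 hn3 hx
    rw [hval1] at h
    have han := ha0 n
    set M2 := (factorialMoment P (ξ n 0) 2).toReal
    set M3 := (factorialMoment P (ξ n 0) 3).toReal with hM3
    have hM3' : 0 ≤ M3 := ENNReal.toReal_nonneg
    have e : x - compGF P (ξ n 0) x - a n * (x + ν / 2 * x ^ 2)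
        = -(compGF P (ξ n 0) x - (1 - a n) * x + M2 / 2 * x ^ 2)
          + (M2 / a n - ν) * (a n * (x ^ 2 / 2)) := by
      field_simp
      ring
    have hx2 : x ^ 2 / 2 ≤ x := by nlinarith [hx.1, hx.2]
    have hx3 : x ^ 3 ≤ x := pow_le_of_le_one hx.1 hx.2 three_ne_zero
    rw [e]
    refine (abs_add_le _ _).trans ?_
    rw [abs_neg, abs_mul, abs_of_nonneg (mul_nonneg han.le (by positivity : 0 ≤ x ^ 2 / 2))]
    have t1 : M3 / 6 * x ^ 3 ≤ M3 / a n * (a n * x) := by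
      have : M3 / a n * (a n * x) = M3 * x := by field_simp
      rw [this]
      exact mul_le_mul (by linarith) hx3 (pow_nonneg hx.1 _) hM3'
    have t2 : |M2 / a n - ν| * (a n * (x ^ 2 / 2)) ≤ |M2 / a n - ν| * (a n * x) :=
      mul_le_mul_of_nonneg_left (mul_le_mul_of_nonneg_left hx2 han.le) (abs_nonneg _)
    have t3 := mul_le_mul_of_nonneg_right hnδ.le (mul_nonneg han.le hx.1)
    rw [add_mul] at t3
    linarith

/-- The limit theorem in terms of a primitive `H` of `x ↦ p x / (1 + r x)`, where `x * p x` is the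
limit of the relative immigration functions. -/
theorem IsBranchingInput.exists_limit (hinput : IsBranchingInput P ξ ε) {a : ℕ → ℝ}
    (ha0 : ∀ n, 0 < a n) (halim : Tendsto a atTop (𝓝 0)) (hasum : ¬ Summable a)
    (hU1 : ∀ n, ∀ x ∈ Set.Icc (0 : ℝ) 1, compGF P (ξ n 0) x ≤ (1 - a n) * x)
    {r : ℝ} (hr : 0 ≤ r)
    (hU2 : ∀ δ > 0, ∀ᶠ n in atTop, ∀ x ∈ Set.Icc (0 : ℝ) 1,
      |x - compGF P (ξ n 0) x - a n * (x + r * x ^ 2)| ≤ δ * (a n * x))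
    {p : ℝ → ℝ} (hp : Continuous p)
    (hV : ∀ δ > 0, ∀ᶠ n in atTop, ∀ x ∈ Set.Icc (0 : ℝ) 1,
      |compGF P (ε n) x - a n * (x * p x)| ≤ δ * (a n * x))
    {H : ℝ → ℝ} (hH0 : H 0 = 0)
    (hH : ∀ x, 0 ≤ x → HasDerivAt H (p x / (1 + r * x)) x) :
    ∃ (μ : Measure ℕ) (_ : IsProbabilityMeasure μ),
      TendstoInDistribution (processWithImmigration ξ ε) atTop (id : ℕ → ℕ) (fun _ => P) μ ∧
      IsCompoundPoisson μ ∧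
      ∀ s ∈ Set.Icc (0 : ℝ) 1, ∫ y, s ^ y ∂μ = Real.exp (-H (1 - s)) := by
  have hU0 : ∀ n, ∀ x ∈ Set.Icc (0 : ℝ) 1, 0 ≤ compGF P (ξ n 0) x := fun n x hx =>
    (compGF_mem (hinput.measurable_offspring n 0) hx).1
  have hVmem : ∀ n, ∀ x ∈ Set.Icc (0 : ℝ) 1, compGF P (ε n) x ∈ Set.Icc (0 : ℝ) 1 := fun n x hx =>
    compGF_mem (hinput.measurable_immigration n) hx
  -- `p` has alternating coefficients; its sign comes from being the limit of the nonnegative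
  -- quotients `compGF P (ε n) x / (a n * x)`. This yields monotonicity of `H`.
  have hp0 : ∀ x ∈ Set.Ioo (0 : ℝ) 1, 0 ≤ p x := fun x hx => by
    refine le_of_forall_pos_le_add fun δ hδ => ?_
    obtain ⟨n, hn⟩ := (hV δ hδ).exists
    have hx' := Set.Ioo_subset_Icc_self hx
    have h1 := (abs_le.1 (hn x hx')).2
    have h2 := (hVmem n x hx').1
    have h3 : 0 ≤ a n * x * (p x + δ) := by linarith
    exact nonneg_of_mul_nonneg_right h3 (mul_pos (ha0 n) hx.1)
  have hHc : ContinuousOn H (Set.Icc 0 1) := fun x hx =>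
    (hH x hx.1).continuousAt.continuousWithinAt
  have hHm : MonotoneOn H (Set.Icc 0 1) := by
    refine monotoneOn_of_deriv_nonneg (convex_Icc _ _) hHc ?_ ?_ <;> rw [interior_Icc]
    · exact fun x hx => (hH x hx.1.le).differentiableAt.differentiableWithinAt
    · intro x hx
      rw [(hH x hx.1.le).deriv]
      exact div_nonneg (hp0 x hx) (by have := mul_nonneg hr hx.1.le; linarith)
  have hmain := fun x hx => tendsto_sum_and_prod_chain (x := x)
    (U := fun n => compGF P (ξ n 0)) (V := fun n => compGF P (ε n))
    (fun n => (ha0 n).le) hasum hU0 hU1 hVmem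
    (fun n => compGF_tendsto_zero (hinput.measurable_immigration n)) hH0 hHc hHm
    (fun δ hδ => increment_estimate ha0 halim hr hU0 hU1 hU2 hp hV hH hδ) hx
  obtain ⟨θ, Q, hQ, hval⟩ := hinput.exists_compoundPoisson hH0
    (hH 0 le_rfl).continuousAt.continuousWithinAt fun x hx => (hmain x hx).1
  have hprob : IsProbabilityMeasure (compoundPoisson θ Q) := by
    refine Measure.isProbabilityMeasure_map (Measurable.aemeasurable ?_)
    exact measurable_random_sum measurable_fst
      fun i => (measurable_pi_apply i).comp measurable_snd
  refine ⟨compoundPoisson θ Q, hprob, ?_, ⟨θ, Q, hQ, rfl⟩, hval⟩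
  refine tendstoInDistribution_of_tendsto_integral_pow (measurable_process
    hinput.measurable_offspring hinput.measurable_immigration) fun s hs => ?_
  have hs' := one_sub_mem ⟨hs.1, hs.2.le⟩
  rw [hval s ⟨hs.1, hs.2.le⟩]
  refine (hmain (1 - s) hs').2.congr fun n => ?_
  have := hinput.integral_pow_process n hs'
  rw [sub_sub_cancel] at this
  exact this.symm

end Limit

end BranchingImmigration

/-! ### Translation of the hypotheses to real numbers and choice of the primitive. -/

theorem theorem2 {Ω : Type*} [MeasurableSpace Ω] (P : Measure Ω) [IsProbabilityMeasure P]
    (ξ : ℕ → ℕ → Ω → ℕ) (ε : ℕ → Ω → ℕ)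
    (hinput : BranchingImmigration.IsBranchingInput P ξ ε)
    -- nearly critical offspring means, with non-summable defects
    (hmean_lt : ∀ n, BranchingImmigration.offspringMean P ξ n < 1)
    (hmean_lim : Tendsto (BranchingImmigration.offspringMean P ξ) atTop (𝓝 1))
    (hmean_sum : ∑' n, (1 - BranchingImmigration.offspringMean P ξ n) = ∞)
    -- second derivatives of the offspring generating functions at 1
    (ν : ℝ≥0)
    (hsecond : Tendsto (fun n => BranchingImmigration.factorialMoment P (ξ n 0) 2 /
      (1 - BranchingImmigration.offspringMean P ξ n)) atTop (𝓝 (ν : ℝ≥0∞)))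
    -- third derivatives of the offspring generating functions at 1
    (hthird : 0 < ν → Tendsto (fun n => BranchingImmigration.factorialMoment P (ξ n 0) 3 /
      (1 - BranchingImmigration.offspringMean P ξ n)) atTop (𝓝 0))
    -- factorial moments of the immigration
    (K : ℕ) (hK : 1 ≤ K) (lam : ℕ → ℝ≥0)
    (himm : ∀ k, 1 ≤ k → k ≤ K →
      Tendsto (fun n => BranchingImmigration.factorialMoment P (ε n) k /
        ((k.factorial : ℝ≥0∞) * (1 - BranchingImmigration.offspringMean P ξ n)))
        atTop (𝓝 (lam k : ℝ≥0∞)))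
    (hlamK : lam K = 0) :
    ∃ (μ : Measure ℕ) (_ : IsProbabilityMeasure μ),
      TendstoInDistribution (BranchingImmigration.processWithImmigration ξ ε) atTop
        (id : ℕ → ℕ) (fun _ => P) μ ∧
      BranchingImmigration.IsCompoundPoisson μ ∧
      (0 < ν → ∀ s ∈ Set.Icc (0 : ℝ) 1,
        ∫ y, s ^ y ∂μ = BranchingImmigration.limitGF ν (fun k => (lam k : ℝ)) K s) ∧
      (ν = 0 → ∀ s ∈ Set.Icc (0 : ℝ) 1,
        ∫ y, s ^ y ∂μ = BranchingImmigration.limitGFZero (fun k => (lam k : ℝ)) K s) := by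
  set a : ℕ → ℝ := fun n => 1 - (BranchingImmigration.offspringMean P ξ n).toReal with ha
  have hofReal : ∀ n, 1 - BranchingImmigration.offspringMean P ξ n = ENNReal.ofReal (a n) :=
    fun n => by
      rw [ha, ENNReal.ofReal_sub _ ENNReal.toReal_nonneg, ENNReal.ofReal_one,
        ENNReal.ofReal_toReal ((hmean_lt n).trans ENNReal.one_lt_top).ne]
  have ha0 : ∀ n, 0 < a n := fun n => by
    rw [← ENNReal.ofReal_pos, ← hofReal]
    exact tsub_pos_of_lt (hmean_lt n)
  have halim : Tendsto a atTop (𝓝 0) := by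
    simpa using ((ENNReal.tendsto_toReal ENNReal.one_ne_top).comp hmean_lim).const_sub 1
  have hasum : ¬ Summable a := fun h => by
    simp_rw [hofReal] at hmean_sum
    exact h.tsum_ofReal_ne_top hmean_sum
  have hm1 : ∀ n, BranchingImmigration.factorialMoment P (ξ n 0) 1 =
      BranchingImmigration.offspringMean P ξ n :=
    fun n => BranchingImmigration.factorialMoment_one _ _
  have hU1 : ∀ n, ∀ x ∈ Set.Icc (0 : ℝ) 1,
      BranchingImmigration.compGF P (ξ n 0) x ≤ (1 - a n) * x := fun n x hx => by
    have h := BranchingImmigration.compGF_le_mean (hinput.measurable_offspring n 0)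
      (by rw [hm1]; exact ((hmean_lt n).trans ENNReal.one_lt_top).ne) hx
    rw [hm1] at h
    rwa [ha, sub_sub_cancel]
  have hratio : ∀ {k : ℕ} {L : ℝ≥0}, Tendsto (fun n =>
      BranchingImmigration.factorialMoment P (ξ n 0) k /
        (1 - BranchingImmigration.offspringMean P ξ n)) atTop (𝓝 (L : ℝ≥0∞)) →
      (∀ᶠ n in atTop, BranchingImmigration.factorialMoment P (ξ n 0) k ≠ ∞) ∧
      Tendsto (fun n => (BranchingImmigration.factorialMoment P (ξ n 0) k).toReal / a n) atTop
        (𝓝 (L : ℝ)) := fun {k L} h => by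
    have h' := BranchingImmigration.tendsto_toReal_ratio hmean_lt (L := L) (c := 1)
      (M := fun n => BranchingImmigration.factorialMoment P (ξ n 0) k) (by simpa using h)
    simpa using h'
  have hU2 := fun δ (hδ : δ > (0 : ℝ)) => BranchingImmigration.offspring_expansion
    hinput.measurable_offspring hmean_lt (fun _ => rfl) ha0 ν.coe_nonneg (hratio hsecond)
    (fun h => hratio (L := 0) (by simpa using hthird (by exact_mod_cast h))) hδ
  have hV := fun δ (hδ : δ > (0 : ℝ)) => BranchingImmigration.immigration_expansion (P := P)
    hinput.measurable_immigration ha0 hK (lam := fun k => (lam k : ℝ))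
    (fun k hk hk' => BranchingImmigration.tendsto_toReal_ratio hmean_lt (himm k hk hk')) (by simp [hlamK]) hδ
  have hp : Continuous fun x : ℝ => ∑ k ∈ Finset.Icc 1 (K - 1), (lam k : ℝ) * (-x) ^ (k - 1) := by
    fun_prop
  have hr : (0 : ℝ) ≤ (ν : ℝ) / 2 := by positivity
  -- The cases differ only in the explicit primitive of `p / (1 + ν / 2 * x)` vanishing at `0`: a
  -- polynomial if `ν = 0`, otherwise with logarithms.
  rcases eq_or_ne ν 0 with hν | hν
  · obtain ⟨μ, hμ, h1, h2, h3⟩ := hinput.exists_limit ha0 halim hasum hU1 hr hU2 hp hV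
      (H := fun x => -∑ k ∈ Finset.Icc 1 (K - 1), (-1) ^ k * (lam k : ℝ) * x ^ k / k)
      (by
        simp only [neg_eq_zero]
        refine Finset.sum_eq_zero fun k hk => ?_
        have : k ≠ 0 := by have := (Finset.mem_Icc.1 hk).1; omega
        simp [this])
      fun x _ => by
        simpa [hν] using BranchingImmigration.hasDerivAt_limitGFZero_exponent
          (fun k => (lam k : ℝ)) K x
    refine ⟨μ, hμ, h1, h2, fun h => absurd hν h.ne', fun _ s hs => ?_⟩
    rw [h3 s hs, neg_neg, BranchingImmigration.limitGFZero]
  · have hpos : 0 < ν := pos_iff_ne_zero.2 hν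
    obtain ⟨μ, hμ, h1, h2, h3⟩ := hinput.exists_limit ha0 halim hasum hU1 hr hU2 hp hV
      (H := fun x => ∑ k ∈ Finset.Icc 1 (K - 1), 2 ^ k * (lam k : ℝ) / (ν : ℝ) ^ k *
        (Real.log (1 + ν / 2 * x) +
          ∑ i ∈ Finset.Icc 1 (k - 1), (-1) ^ i * ((ν : ℝ) ^ i / (i * 2 ^ i)) * x ^ i))
      (by
        refine Finset.sum_eq_zero fun k _ => ?_
        rw [Finset.sum_eq_zero fun i hi => ?_]
        · simp
        · have : i ≠ 0 := by have := (Finset.mem_Icc.1 hi).1; omega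
          simp [this])
      fun x hx => BranchingImmigration.hasDerivAt_limitGF_exponent
        (by exact_mod_cast hpos) (fun k => (lam k : ℝ)) K hx
    refine ⟨μ, hμ, h1, h2, fun _ s hs => ?_, fun h => absurd h hν⟩
    rw [h3 s hs, BranchingImmigration.limitGF]
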